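/- Let $A$ be a commutative ring of functions of the times $t_1=x,t_2,\dots$ and $\bar t_1,\bar t_2,\dots$, with pairwise commuting derivations $\partial/\partial t_l$, $\partial/\partial\bar t_s$ ($l,s\ge1$); write $\partial=\partial/\partial t_1$, $\bar\partial=\partial/\partial\bar t_1$, let $D,\bar D$ be the corresponding symbols in the formal pseudo-differential operators over $(A,\partial)$ and $(A,\bar\partial)$, let $(\cdot)_+$ be the purely differential part, and write $d\ln f=df/f$ for a derivation $d$ and an invertible $f$. Let $\mathcal L=D+\sum_{i\ge1}u_iD^{-i}$ satisfy the KP hierarchy $\partial\mathcal L/\partial t_l=[(\mathcal L^l)_+,\mathcal L]$, and let $\Phi_j,\Psi_j$ ($j\ge1$) be eigenfunctions and adjoint eigenfunctions: $$\frac{\partial\Phi_j}{\partial t_l}=(\mathcal L^l)_+(\Phi_j),\qquad \frac{\partial\Psi_j}{\partial t_l}=-\big((\mathcal L^*)^l\big)_+(\Psi_j).$$ For $j,k\ge 1$ let $\partial^{-1}(\Phi_j\Psi_k)\in A$ be a fixed function with $x$-derivative $\Phi_j\Psi_k$. Suppose that for all $s,k\ge1$ $$\frac{\partial\mathcal L}{\partial\bar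 t_s}=\Big[\sum_{j=1}^s\Phi_{s-j+1}D^{-1}\Psi_j,\ \mathcal L\Big],$$ $$\frac{\partial\Phi_k}{\partial\bar t_s}=\sum_{j=1}^s\Phi_{s-j+1}\partial^{-1}(\Psi_j\Phi_k)-\Phi_{k+s},\qquad \frac{\partial\Psi_k}{\partial\bar t_s}=\sum_{j=1}^s\Psi_j\partial^{-1}(\Phi_{s-j+1}\Psi_k)+\Psi_{k+s}.$$ Put $W_k=\det\|\partial^{\alpha-1}\Phi_\beta\|_{\alpha,\beta=1}^k$ and $\mathcal W_k=\det\|\partial^{\alpha-1}\Psi_\beta\|_{\alpha,\beta=1}^k$ (so $W_0=\mathcal W_0=1$), let $\mathcal W_k(F)$ be the Wronskian of $\Psi_1,\dots,\Psi_k,F$, and assume that all $W_k$ and $\mathcal W_k$ are invertible. For $s\ge1$ define the $\bar\partial$-differential operator $$\bar M_s=\sum_{j=1}^s\Big(\sum_{k=j}^s\frac{\Phi_{s-k+1}}{\Phi_1}\frac{\mathcal W_{j-1}(\Psi_k)}{\mathcal W_j}\Big)\Big(\bar D-\bar\partial\ln\frac{\mathcal W_{j-1}}{\mathcal W_{j-2}}\Big)\cdots\Big(\bar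 D-\bar\partial\ln\Psi_1\Big)\Big(\bar D-\bar\partial\ln\frac1{\Phi_1}\Big)-\frac{\partial}{\partial\bar t_s}\ln\Phi_1,$$ where the product in the $j$-th term has $j$ factors (for $j=1$ only the factor $\bar D-\bar\partial\ln(1/\Phi_1)$). Then there are $b_1,b_2,\dots\in A$ such that the operator $$\bar{\mathcal L}=\bar D+\sum_{k=1}^\infty b_k\Big(\bar D+\bar\partial\ln\frac{W_{k+1}}{W_k}\Big)^{-1}\cdots\Big(\bar D+\bar\partial\ln\frac{W_2}{\Phi_1}\Big)^{-1}$$ satisfies $$\bar M_s=(\bar{\mathcal L}^s)_+\qquad\text{for all } s\ge1,$$ with $b_1=-\bar\partial(\Phi_2/\Phi_1)$ and, for $k\ge2$, $b_k=-\bar\partial(\Phi_{k+1}/\Phi_1)+R_k$, where the remainder $R_k$ involves only $\Phi_1,\dots,\Phi_k$: it is the value of a polynomial with integer coefficients, depending on $k$ only and not on the ring or the solution, at the functions $\bar\partial^n(\Phi_{j+1}/\Phi_1)$ and $\bar\partial^n\big(\bar\partial\ln(W_{j+1}/W_j)\big)$ with $1\le j\le k-1$, $n\ge0$. -/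

import Mathlib

universe u

/-- A formal pseudo-differential operator `∑_{n ≤ N} a_n Dⁿ` over the commutative differential ring
`(A, δ)`, where `D` is the operator symbol of the derivation `δ`; `coeff n` is `a_n`. -/
@[ext]
structure PseudoDiffOp {A : Type*} [CommRing A] (δ : Derivation ℤ A A) where
  coeff : ℤ → A
  bounded : ∃ N : ℤ, ∀ n, N < n → coeff n = 0

namespace PseudoDiffOp

section

variable {A : Type*} [CommRing A] {δ : Derivation ℤ A A}

instance : Zero (PseudoDiffOp δ) := ⟨⟨fun _ => 0, 0, fun _ _ => rfl⟩⟩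

instance : Add (PseudoDiffOp δ) :=
  ⟨fun P Q => ⟨fun n => P.coeff n + Q.coeff n, by
    obtain ⟨N, hN⟩ := P.bounded
    obtain ⟨M, hM⟩ := Q.bounded
    refine ⟨max N M, fun n hn => ?_⟩
    rw [hN n (lt_of_le_of_lt (le_max_left _ _) hn), hM n (lt_of_le_of_lt (le_max_right _ _) hn),
      add_zero]⟩⟩

instance : Neg (PseudoDiffOp δ) :=
  ⟨fun P => ⟨fun n => -P.coeff n, by
    obtain ⟨N, hN⟩ := P.bounded
    exact ⟨N, fun n hn => by rw [hN n hn, neg_zero]⟩⟩⟩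

instance : Sub (PseudoDiffOp δ) :=
  ⟨fun P Q => ⟨fun n => P.coeff n - Q.coeff n, by
    obtain ⟨N, hN⟩ := (P + -Q).bounded
    exact ⟨N, fun n hn => by rw [sub_eq_add_neg]; exact hN n hn⟩⟩⟩

instance : SMul ℕ (PseudoDiffOp δ) :=
  ⟨fun m P => ⟨fun n => m • P.coeff n, by
    obtain ⟨N, hN⟩ := P.bounded
    exact ⟨N, fun n hn => by rw [hN n hn, smul_zero]⟩⟩⟩

instance : SMul ℤ (PseudoDiffOp δ) :=
  ⟨fun m P => ⟨fun n => m • P.coeff n, by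
    obtain ⟨N, hN⟩ := P.bounded
    exact ⟨N, fun n hn => by rw [hN n hn, smul_zero]⟩⟩⟩

/-- Coefficientwise addition. -/
instance : AddCommGroup (PseudoDiffOp δ) :=
  Function.Injective.addCommGroup (fun P : PseudoDiffOp δ => P.coeff)
    (fun _ _ h => PseudoDiffOp.ext h) rfl (fun _ _ => rfl) (fun _ => rfl) (fun _ _ => rfl)
    (fun _ _ => rfl) (fun _ _ => rfl)

/-- The operator `a Dⁿ`. -/
def monomial (a : A) (n : ℤ) : PseudoDiffOp δ :=
  ⟨fun m => if m = n then a else 0, n, fun m hm => if_neg hm.ne'⟩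

/-- The multiplication (zero-order) operator by `a`. -/
def C (a : A) : PseudoDiffOp δ := monomial a 0

/-- The operator `Dⁿ`, `n ∈ ℤ`. -/
def D (n : ℤ) : PseudoDiffOp δ := monomial 1 n

instance : One (PseudoDiffOp δ) := ⟨D 0⟩

theorem iterate_zero (δ : Derivation ℤ A A) (k : ℕ) : (δ^[k]) (0 : A) = 0 := by
  induction k with
  | zero => rfl
  | succ k ih => rw [Function.iterate_succ_apply', ih, map_zero]

/-- The coefficient of `Dⁿ` in the product of `∑ a_i Dⁱ` and `∑ b_j Dʲ`, given by
`(a Dⁱ)(b Dʲ) = ∑_{k ≥ 0} binom(i, k) a δᵏ(b) D^{i+j-k}` for all integers `i`, `j`. -/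
noncomputable def mulCoeff (P Q : PseudoDiffOp δ) (n : ℤ) : A :=
  ∑ᶠ p : ℤ × ℕ, Ring.choose p.1 p.2 • (P.coeff p.1 * (δ^[p.2]) (Q.coeff (n - p.1 + p.2)))

theorem mulCoeff_support_finite (P Q : PseudoDiffOp δ) (n : ℤ) :
    (Function.support fun p : ℤ × ℕ =>
      Ring.choose p.1 p.2 • (P.coeff p.1 * (δ^[p.2]) (Q.coeff (n - p.1 + p.2)))).Finite := by
  obtain ⟨N, hN⟩ := P.bounded
  obtain ⟨M, hM⟩ := Q.bounded
  refine ((Set.finite_Icc (n - M) N).prod (Set.finite_Iic (M + N - n).toNat)).subset ?_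
  rintro ⟨i, k⟩ h
  have h1 : i ≤ N := by
    by_contra hc
    exact h (by simp [hN i (not_le.1 hc)])
  have h2 : n - i + k ≤ M := by
    by_contra hc
    exact h (by simp [hM _ (not_le.1 hc), iterate_zero])
  simp only [Set.mem_prod, Set.mem_Icc, Set.mem_Iic]
  omega

theorem mulCoeff_eq_zero (P Q : PseudoDiffOp δ) {N M : ℤ} (hN : ∀ n, N < n → P.coeff n = 0)
    (hM : ∀ n, M < n → Q.coeff n = 0) (n : ℤ) (hn : N + M < n) : mulCoeff P Q n = 0 := by
  refine (finsum_congr fun p => ?_).trans finsum_zero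
  rcases lt_or_ge N p.1 with h | h
  · simp [hN _ h]
  · rw [hM _ (by omega), iterate_zero, mul_zero, smul_zero]

noncomputable instance : Mul (PseudoDiffOp δ) :=
  ⟨fun P Q => ⟨mulCoeff P Q, by
    obtain ⟨N, hN⟩ := P.bounded
    obtain ⟨M, hM⟩ := Q.bounded
    exact ⟨N + M, mulCoeff_eq_zero P Q hN hM⟩⟩⟩

/-- Powers `P ^ 0 = 1`, `P ^ (s + 1) = P ^ s * P`. -/
noncomputable instance : Pow (PseudoDiffOp δ) ℕ :=
  ⟨fun P s => Nat.rec 1 (fun _ Q => Q * P) s⟩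

/-- The purely differential part `P₊ = ∑_{n ≥ 0} a_n Dⁿ`. -/
def pos (P : PseudoDiffOp δ) : PseudoDiffOp δ :=
  ⟨fun n => if 0 ≤ n then P.coeff n else 0, by
    obtain ⟨N, hN⟩ := P.bounded
    exact ⟨N, fun n hn => by rw [hN n hn, ite_self]⟩⟩

/-- The action `P(f) = ∑_{n ≥ 0} a_n δⁿ(f)` of a differential operator on a function.
It is only used for purely differential operators. -/
noncomputable def act (P : PseudoDiffOp δ) (f : A) : A :=
  ∑ᶠ n : ℕ, P.coeff n * (δ^[n]) f

/-- The formal adjoint `∑ a_i Dⁱ ↦ ∑ (-D)ⁱ a_i`, that is, the coefficient of `Dⁿ` is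
`∑_{k ≥ 0} (-1)^{n+k} binom(n+k, k) δᵏ(a_{n+k})`. -/
noncomputable def adjoint (P : PseudoDiffOp δ) : PseudoDiffOp δ :=
  ⟨fun n => ∑ᶠ k : ℕ, (((n + k).negOnePow : ℤ) * Ring.choose (n + k) k) •
      (δ^[k]) (P.coeff (n + k)), by
    obtain ⟨N, hN⟩ := P.bounded
    refine ⟨N, fun n hn => (finsum_congr fun k => ?_).trans finsum_zero⟩
    rw [hN _ (by omega), iterate_zero, smul_zero]⟩

/-- The operator obtained by applying a derivation `d` to every coefficient. -/
def mapCoeff (d : Derivation ℤ A A) (P : PseudoDiffOp δ) : PseudoDiffOp δ :=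
  ⟨fun n => d (P.coeff n), by
    obtain ⟨N, hN⟩ := P.bounded
    exact ⟨N, fun n hn => by rw [hN n hn, map_zero]⟩⟩

/-- The inverse `(D + f)⁻¹ = ∑_{m ≥ 1} c_m D⁻ᵐ` with `c_1 = 1`, `c_{m+1} = -(δ c_m + f c_m)`. -/
def invDAdd (f : A) : PseudoDiffOp δ :=
  ⟨fun n => if n < 0 then ((fun g => -(δ g + f * g))^[(-n - 1).toNat]) 1 else 0, 0,
    fun n hn => if_neg hn.le.not_gt⟩

theorem D_add_C_mul_coeff (f : A) (P : PseudoDiffOp δ) (n : ℤ) :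
    ((D 1 + C f) * P).coeff n = P.coeff (n - 1) + (δ (P.coeff n) + f * P.coeff n) := by
  change mulCoeff _ _ n = _
  unfold mulCoeff
  rw [finsum_eq_sum_of_support_subset (s := {(1, 0), (1, 1), (0, 0)})]
  · rw [Finset.sum_insert (by decide), Finset.sum_insert (by decide), Finset.sum_singleton]
    have h1 : (D 1 + C f : PseudoDiffOp δ).coeff 1 = 1 := by
      change (if (1 : ℤ) = 1 then (1 : A) else 0) + (if (1 : ℤ) = 0 then f else 0) = 1
      simp
    have h0 : (D 1 + C f : PseudoDiffOp δ).coeff 0 = f := by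
      change (if (0 : ℤ) = 1 then (1 : A) else 0) + (if (0 : ℤ) = 0 then f else 0) = f
      simp
    simp [h1, h0, Ring.choose_one_right]
  · rintro ⟨i, k⟩ h
    have hi : i = 0 ∨ i = 1 := by
      by_contra hc
      push Not at hc
      refine h ?_
      have : (D 1 + C f : PseudoDiffOp δ).coeff i = 0 := by
        change (if i = 1 then (1 : A) else 0) + (if i = 0 then f else 0) = 0
        simp [hc.1, hc.2]
      simp [this]
    have hk : (k : ℤ) ≤ i := by
      by_contra hc
      refine h ?_
      have : Ring.choose i k = 0 := by
        obtain ⟨m, rfl⟩ : ∃ m : ℕ, i = m := ⟨i.toNat, by omega⟩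
        rw [Ring.choose_natCast, Nat.choose_eq_zero_of_lt (by omega)]
        rfl
      simp [this]
    rcases hi with rfl | rfl
    · obtain rfl : k = 0 := by omega
      simp
    · obtain rfl | rfl : k = 0 ∨ k = 1 := by omega
      · simp
      · simp

theorem D_add_C_mul_invDAdd (f : A) :
    (D 1 + C f : PseudoDiffOp δ) * invDAdd f = 1 := by
  ext n
  rw [D_add_C_mul_coeff]
  change (if n - 1 < 0 then _ else (0 : A)) + (δ (if n < 0 then _ else (0 : A)) +
    f * (if n < 0 then _ else (0 : A))) = if n = 0 then (1 : A) else 0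
  rcases lt_trichotomy n 0 with h | h | h
  · rw [if_pos (by omega), if_pos h, if_neg h.ne,
      show (-(n - 1) - 1).toNat = (-n - 1).toNat + 1 by omega, Function.iterate_succ_apply']
    ring
  · subst h
    simp
  · rw [if_neg (by omega), if_neg (by omega), if_neg (by omega)]
    simp

end

end PseudoDiffOp

namespace KP

section

variable {A : Type*} [CommRing A]

/-- The quotient `a / b`; only used when `b` is invertible. -/
noncomputable def quo (a b : A) : A := a * Ring.inverse b

/-- The logarithmic derivative `d (ln a) = d a / a`; only used when `a` is invertible. -/
noncomputable def dlog (d : Derivation ℤ A A) (a : A) : A := quo (d a) a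

/-- The Wronskian `det ‖∂^{α-1} f_β‖`, `α, β = 1, …, n`. -/
def wronskian (d : Derivation ℤ A A) {n : ℕ} (f : Fin n → A) : A :=
  (Matrix.of fun i j : Fin n => (d^[(i : ℕ)]) (f j)).det

/-- `W_k = W_k[f_1, …, f_k]` for a sequence `f_1, f_2, …` (so `W_0 = 1`). -/
def W (d : Derivation ℤ A A) (f : ℕ → A) (k : ℕ) : A :=
  wronskian d fun i : Fin k => f (i + 1)

/-- `W_k(F) = W_{k+1}[f_1, …, f_k, F]`. -/
def WApp (d : Derivation ℤ A A) (f : ℕ → A) (k : ℕ) (F : A) : A :=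
  wronskian d (Fin.snoc (fun i : Fin k => f (i + 1)) F : Fin (k + 1) → A)

end

open PseudoDiffOp in
/-- A KP hierarchy with its system of "ghost" symmetry flows, over a commutative ring `A` of
functions of the times `t_1 = x, t_2, …` and `t̄_1, t̄_2, …`.  All sequences are indexed by the
integers `≥ 1`; the values at index `0` play no role. -/
structure GhostHierarchy (A : Type u) [CommRing A] where
  /-- `∂/∂t_l`; in particular `∂ = ∂/∂x = dt 1`. -/
  dt : ℕ → Derivation ℤ A A
  /-- `∂/∂t̄_s`; in particular `∂̄ = dtbar 1`. -/
  dtbar : ℕ → Derivation ℤ A A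
  dt_comm : ∀ l ≥ 1, ∀ m ≥ 1, ∀ f, dt l (dt m f) = dt m (dt l f)
  dtbar_comm : ∀ r ≥ 1, ∀ s ≥ 1, ∀ f, dtbar r (dtbar s f) = dtbar s (dtbar r f)
  dt_dtbar_comm : ∀ l ≥ 1, ∀ s ≥ 1, ∀ f, dt l (dtbar s f) = dtbar s (dt l f)
  /-- The Lax operator `L = D + ∑_{i ≥ 1} u_i D⁻ⁱ`. -/
  L : PseudoDiffOp (dt 1)
  L_coeff_gt : ∀ n > 1, L.coeff n = 0
  L_coeff_one : L.coeff 1 = 1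
  L_coeff_zero : L.coeff 0 = 0
  lax : ∀ l ≥ 1, mapCoeff (dt l) L = pos (L ^ l) * L - L * pos (L ^ l)
  /-- The eigenfunctions `Φ_j`. -/
  Φ : ℕ → A
  /-- The adjoint eigenfunctions `Ψ_j`. -/
  Ψ : ℕ → A
  eigen : ∀ j ≥ 1, ∀ l ≥ 1, dt l (Φ j) = act (pos (L ^ l)) (Φ j)
  adjEigen : ∀ j ≥ 1, ∀ l ≥ 1, dt l (Ψ j) = -act (pos (adjoint L ^ l)) (Ψ j)
  /-- The potentials `S j k = ∂⁻¹(Φ_j Ψ_k)`. -/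
  S : ℕ → ℕ → A
  dx_S : ∀ j ≥ 1, ∀ k ≥ 1, dt 1 (S j k) = Φ j * Ψ k
  /-- `∂L/∂t̄_s = [M_s, L]` with `M_s = ∑_{j=1}^s Φ_{s-j+1} D⁻¹ Ψ_j`. -/
  ghost_L : ∀ s ≥ 1, mapCoeff (dtbar s) L =
    (∑ j ∈ Finset.Icc 1 s, C (Φ (s + 1 - j)) * D (-1) * C (Ψ j)) * L -
      L * ∑ j ∈ Finset.Icc 1 s, C (Φ (s + 1 - j)) * D (-1) * C (Ψ j)
  ghost_Φ : ∀ s ≥ 1, ∀ k ≥ 1, dtbar s (Φ k) =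
    ∑ j ∈ Finset.Icc 1 s, Φ (s + 1 - j) * S k j - Φ (k + s)
  ghost_Ψ : ∀ s ≥ 1, ∀ k ≥ 1, dtbar s (Ψ k) =
    ∑ j ∈ Finset.Icc 1 s, Ψ j * S (s + 1 - j) k + Ψ (k + s)
  /-- The Wronskians of the `Φ_j` and of the `Ψ_j`, by which one divides, are invertible. -/
  isUnit_W_Φ : ∀ k ≥ 1, IsUnit (W (dt 1) Φ k)
  isUnit_W_Ψ : ∀ k ≥ 1, IsUnit (W (dt 1) Ψ k)

namespace GhostHierarchy

open PseudoDiffOp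

section

variable {A : Type u} [CommRing A] (G : GhostHierarchy A)

/-- `∂̄ = ∂/∂t̄_1`. -/
def dbar : Derivation ℤ A A := G.dtbar 1

/-- The product
`(D̄ - ∂̄ ln(𝒲_{j-1}/𝒲_{j-2})) ⋯ (D̄ - ∂̄ ln Ψ_1) (D̄ - ∂̄ ln(1/Φ_1))` of `j` factors, where `𝒲_k` is
the Wronskian of `Ψ_1, …, Ψ_k`. -/
noncomputable def factors : ℕ → PseudoDiffOp G.dbar
  | 0 => 1
  | 1 => D 1 - C (dlog G.dbar (quo 1 (G.Φ 1)))
  | j + 2 => (D 1 - C (dlog G.dbar (quo (W (G.dt 1) G.Ψ (j + 1)) (W (G.dt 1) G.Ψ j)))) *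
      factors (j + 1)

/-- The `∂̄`-differential operator
`M̄_s = ∑_{j=1}^s (∑_{k=j}^s (Φ_{s-k+1}/Φ_1) 𝒲_{j-1}(Ψ_k)/𝒲_j) (D̄ - ∂̄ ln(𝒲_{j-1}/𝒲_{j-2})) ⋯
(D̄ - ∂̄ ln Ψ_1) (D̄ - ∂̄ ln(1/Φ_1)) - ∂(ln Φ_1)/∂t̄_s`. -/
noncomputable def Mbar (s : ℕ) : PseudoDiffOp G.dbar :=
  ∑ j ∈ Finset.Icc 1 s,
    C (∑ k ∈ Finset.Icc j s, quo (G.Φ (s + 1 - k)) (G.Φ 1) *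
      quo (WApp (G.dt 1) G.Ψ (j - 1) (G.Ψ k)) (W (G.dt 1) G.Ψ j)) * G.factors j -
  C (dlog (G.dtbar s) (G.Φ 1))

/-- `∂̄ ln(W_{k+1}/W_k)`, where `W_k` is the Wronskian of `Φ_1, …, Φ_k`. -/
noncomputable def dlogRatio (k : ℕ) : A :=
  dlog G.dbar (quo (W (G.dt 1) G.Φ (k + 1)) (W (G.dt 1) G.Φ k))

/-- `Φ_{k+1}/Φ_1`. -/
noncomputable def ratio (k : ℕ) : A := quo (G.Φ (k + 1)) (G.Φ 1)

/-- `(D̄ + ∂̄ ln(W_{k+1}/W_k))⁻¹ ⋯ (D̄ + ∂̄ ln(W_2/W_1))⁻¹`, where `W_1 = Φ_1`. -/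
noncomputable def invFactors : ℕ → PseudoDiffOp G.dbar
  | 0 => 1
  | k + 1 => invDAdd (G.dlogRatio (k + 1)) * invFactors k

theorem invFactors_coeff (k : ℕ) (n : ℤ) (hn : -(k : ℤ) < n) :
    (G.invFactors k).coeff n = 0 := by
  induction k generalizing n with
  | zero => exact if_neg (by simpa using hn.ne')
  | succ k ih =>
    refine mulCoeff_eq_zero (N := -1) (M := -k) _ _ (fun m hm => if_neg (by omega)) ih n ?_
    push_cast at hn
    omega

/-- For given `n` only the `k ≤ -n` contribute to the coefficient of `D̄ⁿ` in the series
`∑_{k ≥ 1} b_k (D̄ + ∂̄ ln(W_{k+1}/W_k))⁻¹ ⋯ (D̄ + ∂̄ ln(W_2/Φ_1))⁻¹`. -/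
theorem tail_support_finite (b : ℕ → A) (n : ℤ) :
    (Function.support fun k : ℕ =>
      if 1 ≤ k then b k * (G.invFactors k).coeff n else 0).Finite := by
  refine (Set.finite_Iic (-n).toNat).subset fun k hk => ?_
  by_contra hc
  rw [Set.mem_Iic] at hc
  exact hk (by simp [G.invFactors_coeff k n (by omega)])

/-- The operator `L̄ = D̄ + ∑_{k ≥ 1} b_k (D̄ + ∂̄ ln(W_{k+1}/W_k))⁻¹ ⋯ (D̄ + ∂̄ ln(W_2/Φ_1))⁻¹`. -/
noncomputable def Lbar (b : ℕ → A) : PseudoDiffOp G.dbar :=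
  D 1 + ⟨fun n => ∑ᶠ k : ℕ, if 1 ≤ k then b k * (G.invFactors k).coeff n else 0, 0,
    fun n hn => (finsum_congr fun k => by
      rw [G.invFactors_coeff k n (by omega), mul_zero, ite_self]).trans finsum_zero⟩

/-- The functions on which the lower terms of `b_k` depend: `∂̄ⁿ(Φ_{j+1}/Φ_1)` and
`∂̄ⁿ(∂̄ ln(W_{j+1}/W_j))` for `1 ≤ j ≤ k - 1` and `n ≥ 0`. -/
noncomputable def lowerJets (k : ℕ) : (Fin (k - 1) × ℕ) ⊕ (Fin (k - 1) × ℕ) → A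
  | .inl (j, n) => (G.dbar^[n]) (G.ratio (j + 1))
  | .inr (j, n) => (G.dbar^[n]) (G.dlogRatio (j + 1))

end

end GhostHierarchy

end KP

/-! ### Pseudo-differential operators form an associative ring. -/

namespace PseudoDiffOp

section

open Finset

/-! The proof is Sato dressing in the barred variable. The operator `dressing`, written `w = ∑
(Φ_{m+1}/Φ_1) D̄⁻ᵐ`, is monic of order zero, and two identities suffice: `M̄_s w = w D̄ˢ + ∂w/∂t̄_s`
(`Mbar_mul_dressing_coeff`) and `L̄ w = w D̄` (`Lbar_mul_dressing`). They give `(M̄_s - L̄ˢ) w =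
∂w/∂t̄_s`, which has negative order because the leading coefficient of `w` is the constant 1. Hence
`M̄_s - L̄ˢ` has negative order, and since `M̄_s` is differential it equals `(L̄ˢ)₊`.

The second identity is solved for the `b_k`. The product of `k` inverse factors, multiplied by `w`,
begins with exactly `D̄⁻ᵏ`, so the system is unitriangular and has the recursive solution
`laxCoeff`. The same recursion yields the polynomial form of the remainders.

The first identity rests on the potentials `S m k = ∂⁻¹(Φ_m Ψ_k)`. The flows determine `∂̄ S m k`
only up to an `x`-constant; commutativity of the flows on `Φ_m`, with the invertible Wronskians of
the `Φ_j`, forces that constant to vanish (`dbar_S`). The operators `potential k` assembled from the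
`S m k` therefore satisfy a first-order recursion starting from `factors 1 * w`. Gaussian
elimination (`potential_eq_sum`) expands them in the `factors j * w` with coefficients
`𝒲_{j-1}(Ψ_k)/𝒲_j`, whose `∂̄`-recursion is linear algebra on the rows of a Wronskian matrix
(`rowSpan_deriv_echelon`). Summed against the `Φ_{s-k+1}/Φ_1`, the potentials reproduce the flow of
the `Φ_{m+1}`. -/

theorem derivation_iterate_add {A : Type*} [CommRing A] (δ : Derivation ℤ A A) (p : ℕ) (f g : A) :
    (δ^[p]) (f + g) = (δ^[p]) f + (δ^[p]) g := by
  induction p with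
  | zero => rfl
  | succ p ih => simp only [Function.iterate_succ_apply', ih, map_add]

theorem derivation_iterate_sum {A ι : Type*} [CommRing A] (δ : Derivation ℤ A A) (p : ℕ)
    (s : Finset ι) (f : ι → A) : (δ^[p]) (∑ i ∈ s, f i) = ∑ i ∈ s, (δ^[p]) (f i) := by
  induction p with
  | zero => rfl
  | succ p ih => simp only [Function.iterate_succ_apply', ih, map_sum]

theorem derivation_iterate_zsmul {A : Type*} [CommRing A] (δ : Derivation ℤ A A) (p : ℕ)
    (c : ℤ) (f : A) : (δ^[p]) (c • f) = c • (δ^[p]) f := by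
  induction p with
  | zero => rfl
  | succ p ih => simp only [Function.iterate_succ_apply', ih, map_zsmul]

/-- The Leibniz rule for iterates of a derivation. -/
theorem derivation_iterate_mul {A : Type*} [CommRing A] (δ : Derivation ℤ A A) (p : ℕ) (f g : A) :
    (δ^[p]) (f * g) =
      ∑ ij ∈ antidiagonal p, (p.choose ij.1 : A) * ((δ^[ij.1]) f * (δ^[ij.2]) g) := by
  induction p with
  | zero => simp
  | succ p ih =>
    rw [Function.iterate_succ_apply', ih, map_sum,
      sum_antidiagonal_choose_succ_mul (fun i j => (δ^[i]) f * (δ^[j]) g), ← sum_add_distrib]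
    refine sum_congr rfl fun ij hij => ?_
    rw [HasAntidiagonal.mem_antidiagonal] at hij
    rw [Nat.choose_symm_of_eq_add hij.symm, ← nsmul_eq_mul, map_nsmul]
    simp only [Function.iterate_succ_apply', Derivation.leibniz, smul_eq_mul, nsmul_eq_mul]
    ring

/-- Regrouping by the total number of derivatives `p + q`: the vanishing hypothesis makes the square
truncation harmless. -/
theorem sum_square_eq_sum_antidiagonal {M : Type*} [AddCommMonoid M] (B : ℕ) (F : ℕ → ℕ → M)
    (hF : ∀ p q, B < p + q → F p q = 0) :
    ∑ p ∈ range (B + 1), ∑ q ∈ range (B + 1), F p q =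
      ∑ t ∈ range (B + 1), ∑ ij ∈ antidiagonal t, F ij.1 ij.2 := by
  rw [← sum_product', sum_sigma']
  symm
  refine sum_of_injOn (fun x => x.2) ?_ ?_ ?_ ?_
  · rintro ⟨t, p, q⟩ h ⟨t', p', q'⟩ h' e
    simp only [coe_sigma, Set.mem_sigma_iff, mem_coe, HasAntidiagonal.mem_antidiagonal, Prod.mk.injEq] at h h' e
    obtain ⟨rfl, rfl⟩ := e
    obtain rfl : t = t' := by omega
    rfl
  · rintro ⟨t, p, q⟩ h
    simp only [coe_sigma, Set.mem_sigma_iff, mem_coe, HasAntidiagonal.mem_antidiagonal, mem_range, mem_product]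
      at h ⊢
    omega
  · rintro ⟨p, q⟩ - h
    refine hF p q ?_
    by_contra hc
    refine h ⟨⟨p + q, p, q⟩, ?_, rfl⟩
    simp only [coe_sigma, Set.mem_sigma_iff, mem_coe, HasAntidiagonal.mem_antidiagonal, mem_range]
    exact ⟨by omega, trivial⟩
  · intros
    rfl

theorem sum_antidiagonal_assoc {M : Type*} [AddCommMonoid M] (t : ℕ) (F : ℕ → ℕ → ℕ → M) :
    ∑ pq ∈ antidiagonal t, ∑ um ∈ antidiagonal pq.1, F um.1 um.2 pq.2 =
      ∑ uv ∈ antidiagonal t, ∑ mq ∈ antidiagonal uv.2, F uv.1 mq.1 mq.2 := by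
  rw [sum_sigma', sum_sigma']
  refine sum_nbij' (fun x => ⟨(x.2.1, x.2.2 + x.1.2), (x.2.2, x.1.2)⟩)
    (fun x => ⟨(x.1.1 + x.2.1, x.2.2), (x.1.1, x.2.1)⟩) ?_ ?_ ?_ ?_ ?_
  · rintro ⟨⟨p, q⟩, u, m⟩ h
    simp only [mem_sigma, HasAntidiagonal.mem_antidiagonal] at h ⊢
    exact ⟨by omega, trivial⟩
  · rintro ⟨⟨p, q⟩, u, m⟩ h
    simp only [mem_sigma, HasAntidiagonal.mem_antidiagonal] at h ⊢
    exact ⟨by omega, trivial⟩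
  · rintro ⟨⟨p, q⟩, u, m⟩ h
    simp only [mem_sigma, HasAntidiagonal.mem_antidiagonal] at h
    obtain ⟨h1, rfl⟩ := h
    rfl
  · rintro ⟨⟨p, q⟩, u, m⟩ h
    simp only [mem_sigma, HasAntidiagonal.mem_antidiagonal] at h
    obtain ⟨h1, rfl⟩ := h
    rfl
  · intros
    rfl

/-- The composition rule behind associativity of pseudo-differential operators. -/
theorem sum_choose_iterate_mul {A : Type*} [CommRing A] (δ : Derivation ℤ A A) (i j : ℤ) (t : ℕ)
    (b h : A) :
    ∑ pq ∈ antidiagonal t, Ring.choose i pq.1 •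
        (δ^[pq.1]) (Ring.choose j pq.2 • (b * (δ^[pq.2]) h)) =
      ∑ uv ∈ antidiagonal t, (Ring.choose i uv.1 * Ring.choose (j + i - uv.1) uv.2) •
        ((δ^[uv.1]) b * (δ^[uv.2]) h) := by
  have h1 : ∀ pq ∈ antidiagonal t, Ring.choose i pq.1 •
        (δ^[pq.1]) (Ring.choose j pq.2 • (b * (δ^[pq.2]) h)) =
      ∑ um ∈ antidiagonal pq.1, (Ring.choose i um.1 * Ring.choose (i - um.1) um.2 *
        Ring.choose j pq.2) • ((δ^[um.1]) b * (δ^[um.2 + pq.2]) h) := by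
    intro pq _
    rw [derivation_iterate_zsmul, derivation_iterate_mul, smul_smul, smul_sum]
    refine sum_congr rfl fun um hum => ?_
    rw [HasAntidiagonal.mem_antidiagonal] at hum
    -- Splitting the `p` derivatives as `u + m` turns the product of binomials into one that factors
    -- over `u` and `m`.
    have h2 := Ring.choose_smul_choose i (n := pq.1) (k := um.1) (by omega)
    rw [show pq.1 - um.1 = um.2 by omega] at h2
    rw [← h2, ← Function.iterate_add_apply]
    simp only [zsmul_eq_mul, nsmul_eq_mul]
    push_cast
    ring
  rw [sum_congr rfl h1, sum_antidiagonal_assoc t (fun u m q =>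
    (Ring.choose i u * Ring.choose (i - u) m * Ring.choose j q) •
      ((δ^[u]) b * (δ^[m + q]) h))]
  refine sum_congr rfl fun uv _ => ?_
  -- Vandermonde's identity collapses the inner sum over `m + q = v`.
  rw [show j + i - (uv.1 : ℤ) = (i - uv.1) + j by ring, Ring.add_choose_eq _ (Commute.all _ _),
    mul_sum, sum_smul]
  refine sum_congr rfl fun mq hmq => ?_
  rw [HasAntidiagonal.mem_antidiagonal] at hmq
  rw [hmq, mul_assoc]

/-- Only the support has to fit in both intervals, so truncation bounds need not correspond under
the substitution. -/
theorem sum_Icc_shift {M : Type*} [AddCommMonoid M] (g : ℤ → M) (c a b a' b' : ℤ)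
    (h : ∀ m, g m ≠ 0 → a ≤ m ∧ m ≤ b) (h' : ∀ m, g m ≠ 0 → a' ≤ m - c ∧ m - c ≤ b') :
    ∑ m ∈ Icc a b, g m = ∑ j ∈ Icc a' b', g (j + c) := by
  refine sum_bij_ne_zero (fun m _ _ => m - c) ?_ ?_ ?_ ?_
  · intro m _ hm
    rw [mem_Icc]
    exact h' m hm
  · intro m _ _ m' _ _ e
    simpa using e
  · intro j _ hj
    exact ⟨j + c, by rw [mem_Icc]; exact h _ hj, hj, by ring⟩
  · intro m _ _
    rw [sub_add_cancel]

variable {A : Type*} [CommRing A] {δ : Derivation ℤ A A}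

@[simp] theorem zero_coeff (n : ℤ) : (0 : PseudoDiffOp δ).coeff n = 0 := rfl
@[simp] theorem add_coeff (P Q : PseudoDiffOp δ) (n : ℤ) :
    (P + Q).coeff n = P.coeff n + Q.coeff n := rfl
@[simp] theorem sub_coeff (P Q : PseudoDiffOp δ) (n : ℤ) :
    (P - Q).coeff n = P.coeff n - Q.coeff n := rfl
theorem C_coeff (a : A) (m : ℤ) :
    (C a : PseudoDiffOp δ).coeff m = if m = 0 then a else 0 := rfl
theorem D_coeff (n m : ℤ) :
    (D n : PseudoDiffOp δ).coeff m = if m = n then 1 else 0 := rfl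

theorem sum_coeff {ι : Type*} (s : Finset ι) (f : ι → PseudoDiffOp δ) (n : ℤ) :
    (∑ i ∈ s, f i).coeff n = ∑ i ∈ s, (f i).coeff n := by
  classical
  induction s using Finset.induction_on with
  | empty => simp
  | insert a s ha ih => simp [sum_insert ha, ih]

theorem mul_coeff_eq_zero {P Q : PseudoDiffOp δ} {N M : ℤ} (hN : ∀ n, N < n → P.coeff n = 0)
    (hM : ∀ n, M < n → Q.coeff n = 0) (n : ℤ) (hn : N + M < n) : (P * Q).coeff n = 0 :=
  mulCoeff_eq_zero P Q hN hM n hn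

/-- A coefficient of a product as a sum over any sufficiently large box. -/
theorem mul_coeff_eq_sum {P Q : PseudoDiffOp δ} {N M : ℤ} (hN : ∀ n, N < n → P.coeff n = 0)
    (hM : ∀ n, M < n → Q.coeff n = 0) (n a : ℤ) (B : ℕ) (ha : a ≤ n - M) (hB : N + M - n ≤ B) :
    (P * Q).coeff n = ∑ i ∈ Icc a N, ∑ k ∈ range (B + 1),
      Ring.choose i k • (P.coeff i * (δ^[k]) (Q.coeff (n - i + k))) := by
  change mulCoeff P Q n = _
  rw [mulCoeff, finsum_eq_sum_of_support_subset (s := Icc a N ×ˢ range (B + 1)), sum_product]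
  rintro ⟨i, k⟩ h
  have h1 : i ≤ N := by
    by_contra hc
    exact h (by simp [hN i (not_le.1 hc)])
  have h2 : n - i + k ≤ M := by
    by_contra hc
    exact h (by simp [hM _ (not_le.1 hc)])
  simp only [coe_product, Set.mem_prod, mem_coe, mem_Icc, mem_range]
  omega

/-- Both triple products are finite sums over a common box. After matching the powers of `D`
contributed by `P` and `Q`, the claim reduces to `sum_choose_iterate_mul` at each total number of
derivatives. -/
protected theorem mul_assoc (P Q R : PseudoDiffOp δ) : P * Q * R = P * (Q * R) := by
  obtain ⟨N, hN⟩ := P.bounded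
  obtain ⟨M, hM⟩ := Q.bounded
  obtain ⟨K, hK⟩ := R.bounded
  ext n
  -- The order drops from at most `N + M + K` to `n`, one unit per derivative, so at most `B`
  -- derivatives occur.
  set B : ℕ := (N + M + K - n).toNat with hB
  rw [mul_coeff_eq_sum (N := N + M) (mul_coeff_eq_zero hN hM) hK n (n - K) B le_rfl (by omega),
    mul_coeff_eq_sum hN (mul_coeff_eq_zero hM hK) n (n - M - K) B (by omega) (by omega)]
  have hL : ∀ m ∈ Icc (n - K) (N + M), ∀ q ∈ range (B + 1),
      Ring.choose m q • ((P * Q).coeff m * (δ^[q]) (R.coeff (n - m + q))) =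
      ∑ i ∈ Icc (n - M - K) N, ∑ p ∈ range (B + 1), (Ring.choose i p * Ring.choose m q) •
        (P.coeff i * ((δ^[p]) (Q.coeff (m - i + p)) * (δ^[q]) (R.coeff (n - m + q)))) := by
    intro m hm q _
    rw [mem_Icc] at hm
    rw [mul_coeff_eq_sum hN hM m (n - M - K) B (by omega) (by omega), sum_mul, smul_sum]
    refine sum_congr rfl fun i _ => ?_
    rw [sum_mul, smul_sum]
    refine sum_congr rfl fun p _ => ?_
    simp only [zsmul_eq_mul]
    push_cast
    ring
  rw [sum_congr rfl fun m hm => sum_congr rfl (hL m hm)]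
  have hc : ∑ m ∈ Icc (n - K) (N + M), ∑ q ∈ range (B + 1), ∑ i ∈ Icc (n - M - K) N,
      ∑ p ∈ range (B + 1), (Ring.choose i p * Ring.choose m q) •
        (P.coeff i * ((δ^[p]) (Q.coeff (m - i + p)) * (δ^[q]) (R.coeff (n - m + q)))) =
      ∑ i ∈ Icc (n - M - K) N, ∑ p ∈ range (B + 1), ∑ q ∈ range (B + 1),
      ∑ m ∈ Icc (n - K) (N + M), (Ring.choose i p * Ring.choose m q) •
        (P.coeff i * ((δ^[p]) (Q.coeff (m - i + p)) * (δ^[q]) (R.coeff (n - m + q)))) := by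
    rw [sum_comm]
    rw [sum_congr rfl fun q _ => sum_comm]
    rw [sum_comm]
    refine sum_congr rfl fun i _ => ?_
    rw [sum_congr rfl fun q _ => sum_comm]
    rw [sum_comm]
  rw [hc]
  refine sum_congr rfl fun i hi => ?_
  rw [mem_Icc] at hi
  have hS : ∀ p ∈ range (B + 1), ∀ q ∈ range (B + 1),
      ∑ m ∈ Icc (n - K) (N + M), (Ring.choose i p * Ring.choose m q) •
        (P.coeff i * ((δ^[p]) (Q.coeff (m - i + p)) * (δ^[q]) (R.coeff (n - m + q)))) =
      ∑ j ∈ Icc (n - N - K) M, (Ring.choose i p * Ring.choose (j + i - p) q) •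
        (P.coeff i * ((δ^[p]) (Q.coeff j) * (δ^[q]) (R.coeff (n - i - j + (p + q : ℕ))))) := by
    intro p _ q _
    have hb : ∀ m, (Ring.choose i p * Ring.choose m q) •
        (P.coeff i * ((δ^[p]) (Q.coeff (m - i + p)) * (δ^[q]) (R.coeff (n - m + q)))) ≠ 0 →
        m - i + p ≤ M ∧ n - m + q ≤ K := by
      intro m h
      constructor
      · by_contra hcon
        exact h (by simp [hM _ (not_le.1 hcon)])
      · by_contra hcon
        exact h (by simp [hK _ (not_le.1 hcon)])
    -- Passes from the exponent `m` in `P * Q` to the exponent `j = m - i + p` in `Q`.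
    rw [sum_Icc_shift _ (i - p) _ _ (n - N - K) M]
    · refine sum_congr rfl fun j _ => ?_
      rw [show j + (i - (p : ℤ)) - i + p = j by ring, add_sub_assoc,
        show n - (j + (i - (p : ℤ))) + q = n - i - j + (p + q : ℕ) by push_cast; ring]
    · intro m h
      have := hb m h
      omega
    · intro m h
      have := hb m h
      omega
  rw [sum_congr rfl fun p hp => sum_congr rfl (hS p hp),
    sum_congr rfl fun p _ => sum_comm]
  have hR : ∀ p ∈ range (B + 1),
      Ring.choose i p • (P.coeff i * (δ^[p]) ((Q * R).coeff (n - i + p))) =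
      ∑ j ∈ Icc (n - N - K) M, P.coeff i * ∑ q ∈ range (B + 1), Ring.choose i p • (δ^[p])
        (Ring.choose j q • (Q.coeff j * (δ^[q]) (R.coeff (n - i - j + (p + q : ℕ))))) := by
    intro p _
    rw [mul_coeff_eq_sum hM hK (n - i + p) (n - N - K) B (by omega) (by omega),
      derivation_iterate_sum, mul_sum, smul_sum]
    refine sum_congr rfl fun j _ => ?_
    rw [derivation_iterate_sum, mul_sum, mul_sum, smul_sum]
    refine sum_congr rfl fun q _ => ?_
    rw [mul_smul_comm, show n - i + (p : ℤ) - j + q = n - i - j + (p + q : ℕ) by push_cast; ring]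
  rw [sum_congr rfl hR]
  refine sum_comm.trans (Eq.trans ?_ sum_comm)
  refine sum_congr rfl fun j hj => ?_
  rw [mem_Icc] at hj
  have hz : ∀ p q : ℕ, B < p + q → R.coeff (n - i - j + (p + q : ℕ)) = 0 := by
    intro p q h
    exact hK _ (by omega)
  rw [← mul_sum,
    sum_square_eq_sum_antidiagonal B (fun p q => Ring.choose i p • (δ^[p])
      (Ring.choose j q • (Q.coeff j * (δ^[q]) (R.coeff (n - i - j + (p + q : ℕ))))))
      (fun p q h => by simp only [hz p q h, iterate_zero, mul_zero, smul_zero]),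
    sum_square_eq_sum_antidiagonal B (fun p q => (Ring.choose i p * Ring.choose (j + i - p) q) •
        (P.coeff i * ((δ^[p]) (Q.coeff j) * (δ^[q]) (R.coeff (n - i - j + (p + q : ℕ))))))
      (fun p q h => by simp only [hz p q h, iterate_zero, mul_zero, smul_zero]), mul_sum]
  refine sum_congr rfl fun t _ => ?_
  have hS' := sum_choose_iterate_mul δ i j t (Q.coeff j) (R.coeff (n - i - j + t))
  have h1 : ∀ (f : ℕ × ℕ → A → A), ∑ pq ∈ antidiagonal t, f pq (R.coeff (n - i - j + t)) =
      ∑ pq ∈ antidiagonal t, f pq (R.coeff (n - i - j + (pq.1 + pq.2 : ℕ))) := by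
    intro f
    refine sum_congr rfl fun pq hpq => ?_
    rw [HasAntidiagonal.mem_antidiagonal.1 hpq]
  rw [h1 fun pq x => Ring.choose i pq.1 • (δ^[pq.1]) (Ring.choose j pq.2 •
      (Q.coeff j * (δ^[pq.2]) x)),
    h1 fun pq x => (Ring.choose i pq.1 * Ring.choose (j + i - pq.1) pq.2) •
      ((δ^[pq.1]) (Q.coeff j) * (δ^[pq.2]) x)] at hS'
  rw [hS', mul_sum]
  refine sum_congr rfl fun pq _ => ?_
  rw [mul_smul_comm]

protected theorem add_mul (P Q R : PseudoDiffOp δ) : (P + Q) * R = P * R + Q * R := by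
  obtain ⟨N, hN⟩ := P.bounded
  obtain ⟨M, hM⟩ := Q.bounded
  obtain ⟨K, hK⟩ := R.bounded
  have hN' : ∀ n, max N M < n → P.coeff n = 0 := fun n h => hN n (by omega)
  have hM' : ∀ n, max N M < n → Q.coeff n = 0 := fun n h => hM n (by omega)
  ext n
  rw [add_coeff, mul_coeff_eq_sum hN' hK n (n - K) (max N M + K - n).toNat (by omega) (by omega),
    mul_coeff_eq_sum hM' hK n (n - K) (max N M + K - n).toNat (by omega) (by omega),
    mul_coeff_eq_sum (P := P + Q) (fun m hm => by rw [add_coeff, hN' m hm, hM' m hm, add_zero])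
      hK n (n - K) (max N M + K - n).toNat (by omega) (by omega), ← sum_add_distrib]
  refine sum_congr rfl fun i _ => ?_
  rw [← sum_add_distrib]
  refine sum_congr rfl fun k _ => ?_
  rw [← smul_add, ← add_mul, add_coeff]

protected theorem mul_add (R P Q : PseudoDiffOp δ) : R * (P + Q) = R * P + R * Q := by
  obtain ⟨N, hN⟩ := P.bounded
  obtain ⟨M, hM⟩ := Q.bounded
  obtain ⟨K, hK⟩ := R.bounded
  have hN' : ∀ n, max N M < n → P.coeff n = 0 := fun n h => hN n (by omega)
  have hM' : ∀ n, max N M < n → Q.coeff n = 0 := fun n h => hM n (by omega)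
  ext n
  rw [add_coeff, mul_coeff_eq_sum hK hN' n (n - max N M) (max N M + K - n).toNat (by omega)
      (by omega),
    mul_coeff_eq_sum hK hM' n (n - max N M) (max N M + K - n).toNat (by omega) (by omega),
    mul_coeff_eq_sum (Q := P + Q) hK (fun m hm => by rw [add_coeff, hN' m hm, hM' m hm, add_zero])
      n (n - max N M) (max N M + K - n).toNat (by omega) (by omega), ← sum_add_distrib]
  refine sum_congr rfl fun i _ => ?_
  rw [← sum_add_distrib]
  refine sum_congr rfl fun k _ => ?_
  rw [← smul_add, ← mul_add, add_coeff, derivation_iterate_add]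

theorem C_mul_coeff (a : A) (P : PseudoDiffOp δ) (n : ℤ) : (C a * P).coeff n = a * P.coeff n := by
  change mulCoeff _ _ n = _
  rw [mulCoeff, finsum_eq_single _ ((0 : ℤ), (0 : ℕ))]
  · simp [C_coeff]
  · rintro ⟨i, k⟩ h
    by_cases hi : i = 0
    · subst hi
      obtain ⟨k, rfl⟩ : ∃ l, k = l + 1 := Nat.exists_eq_succ_of_ne_zero fun hk => h (by rw [hk])
      simp [Ring.choose_zero_succ]
    · simp [C_coeff, hi]

theorem mul_D_coeff (P : PseudoDiffOp δ) (m n : ℤ) : (P * D m).coeff n = P.coeff (n - m) := by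
  change mulCoeff _ _ n = _
  have h1 : ∀ k : ℕ, (δ^[k + 1]) (1 : A) = 0 := fun k => by
    rw [Function.iterate_succ_apply, Derivation.map_one_eq_zero, iterate_zero]
  rw [mulCoeff, finsum_eq_single _ ((n - m : ℤ), (0 : ℕ))]
  · simp [D_coeff]
  · rintro ⟨i, k⟩ h
    simp only [D_coeff]
    split_ifs with hk
    · cases k with
      | zero =>
        refine absurd ?_ h
        simp only [Prod.mk.injEq, and_true]
        push_cast at hk
        omega
      | succ k => rw [h1, mul_zero, smul_zero]
    · rw [iterate_zero, mul_zero, smul_zero]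

/-- The fields `npow` and `zsmul` reuse the existing operations, so ring powers agree definitionally
with the given `P ^ s`. -/
noncomputable instance : Ring (PseudoDiffOp δ) where
  mul_assoc := PseudoDiffOp.mul_assoc
  left_distrib := PseudoDiffOp.mul_add
  right_distrib := PseudoDiffOp.add_mul
  one_mul P := by
    ext n
    exact (C_mul_coeff 1 P n).trans (one_mul _)
  mul_one P := by
    ext n
    exact (mul_D_coeff P 0 n).trans (by rw [sub_zero])
  zero_mul P := by
    ext n
    have := C_mul_coeff (δ := δ) 0 P n
    rw [zero_mul] at this
    rw [zero_coeff, ← this]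
    congr 2
    ext m
    simp [C_coeff]
  mul_zero P := by
    have := PseudoDiffOp.mul_add P 0 0
    rwa [add_zero, left_eq_add] at this
  neg_add_cancel := neg_add_cancel
  zsmul n P := n • P
  zsmul_zero' := zero_zsmul
  zsmul_succ' := fun n a => SubNegMonoid.zsmul_succ' n a
  zsmul_neg' := fun n a => SubNegMonoid.zsmul_neg' n a
  sub_eq_add_neg := sub_eq_add_neg
  npow s P := P ^ s
  npow_zero _ := rfl
  npow_succ _ _ := rfl

end

end PseudoDiffOp

/-! ### Logarithmic derivatives and Wronskians. -/

namespace KP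

section

open Finset

variable {A : Type*} [CommRing A]

theorem dlog_of_mul_eq_one (d : Derivation ℤ A A) {p q : A} (h : p * q = 1) :
    d p + dlog d q * p = 0 := by
  have hq : Ring.inverse q = p := by
    rw [← mul_one (Ring.inverse q), ← h, mul_comm p q, ← mul_assoc,
      Ring.inverse_mul_cancel _ (IsUnit.of_mul_eq_one p (by rw [mul_comm, h])), one_mul]
  have h1 : d (p * q) = 0 := by rw [h, Derivation.map_one_eq_zero]
  rw [Derivation.leibniz, smul_eq_mul, smul_eq_mul] at h1
  rw [dlog, quo, hq]
  linear_combination p * h1 - d p * h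

theorem mul_quo_cancel {a b : A} (hb : IsUnit b) : b * quo a b = a := by
  rw [quo, mul_left_comm, Ring.mul_inverse_cancel _ hb, mul_one]

theorem quo_self {b : A} (hb : IsUnit b) : quo b b = 1 := Ring.mul_inverse_cancel _ hb

theorem map_quo (d : Derivation ℤ A A) {a b : A} (hb : IsUnit b) :
    d (quo a b) = quo (d a) b - dlog d b * quo a b := by
  have h := dlog_of_mul_eq_one d (Ring.inverse_mul_cancel _ hb)
  rw [quo, Derivation.leibniz, smul_eq_mul, smul_eq_mul, quo]
  linear_combination a * h

/-- An invertible Wronskian forces the functions to be linearly independent over the constants. -/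
theorem eq_zero_of_sum_mul_eq_zero (d : Derivation ℤ A A) {f : ℕ → A} {n : ℕ}
    (hW : IsUnit (W d f n)) (y : Fin n → A) (hy : ∀ i, d (y i) = 0)
    (h : ∑ i : Fin n, f (i + 1) * y i = 0) : y = 0 := by
  -- The `y i` are constants, so differentiating the relation reproduces it for every row of the
  -- Wronskian matrix.
  have hd : ∀ a : ℕ, ∑ i : Fin n, (d^[a]) (f (i + 1)) * y i = 0 := by
    intro a
    induction a with
    | zero => exact h
    | succ a ih =>
      have := congrArg d ih
      rw [map_sum, map_zero] at this
      rw [← this]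
      refine sum_congr rfl fun i _ => ?_
      rw [Derivation.leibniz, hy, smul_zero, zero_add, smul_eq_mul, mul_comm,
        Function.iterate_succ_apply']
  refine Matrix.mulVec_injective_of_isUnit ((Matrix.isUnit_iff_isUnit_det _).2 hW) ?_
  rw [Matrix.mulVec_zero]
  ext a
  exact hd a

/-- An invertible Wronskian has linearly independent rows. -/
theorem eq_zero_of_sum_mul_iterate_eq_zero (d : Derivation ℤ A A) {f : ℕ → A} {n : ℕ}
    (hW : IsUnit (W d f n)) (r : ℕ → A)
    (h : ∀ k < n, ∑ a ∈ range n, r a * (d^[a]) (f (k + 1)) = 0) : ∀ a < n, r a = 0 := by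
  have : (fun a : Fin n => r a) = 0 := by
    refine Matrix.vecMul_injective_of_isUnit ((Matrix.isUnit_iff_isUnit_det _).2 hW) ?_
    refine Eq.trans ?_ (Matrix.zero_vecMul _).symm
    ext k
    have := h k k.2
    rw [sum_range] at this
    exact this
  exact fun a ha => congrFun this ⟨a, ha⟩

theorem W_zero (d : Derivation ℤ A A) (f : ℕ → A) : W d f 0 = 1 := Matrix.det_fin_zero

theorem W_one (d : Derivation ℤ A A) (f : ℕ → A) : W d f 1 = f 1 := by
  simp [W, wronskian]

theorem WApp_self (d : Derivation ℤ A A) (f : ℕ → A) (n : ℕ) :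
    WApp d f n (f (n + 1)) = W d f (n + 1) := by
  unfold WApp W
  congr 1
  ext i
  refine Fin.lastCases ?_ (fun i => ?_) i
  · rw [Fin.snoc_last, Fin.val_last]
  · rw [Fin.snoc_castSucc, Fin.val_castSucc]

theorem WApp_eq_zero (d : Derivation ℤ A A) (f : ℕ → A) {n i : ℕ} (hi : i < n) :
    WApp d f n (f (i + 1)) = 0 := by
  refine Matrix.det_zero_of_column_eq (i := Fin.castSucc ⟨i, hi⟩) (j := Fin.last n)
    (Fin.castSucc_lt_last _).ne fun a => ?_
  simp only [Matrix.of_apply, Fin.snoc_castSucc, Fin.snoc_last]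

/-- Expansion of a Wronskian along its last column. -/
theorem WApp_eq_sum (d : Derivation ℤ A A) (f : ℕ → A) (n : ℕ) :
    ∃ R : ℕ → A, R n = W d f n ∧
      ∀ F, WApp d f n F = ∑ a ∈ range (n + 1), R a * (d^[a]) F := by
  let M : Matrix (Fin (n + 1)) (Fin n) A := Matrix.of fun a j => (d^[(a : ℕ)]) (f (j + 1))
  -- The cofactors of the last column do not involve `F`; the value 0 beyond `n` is padding.
  refine ⟨fun a => if h : a < n + 1 then
    (-1) ^ (a + n) * (M.submatrix (Fin.succAbove ⟨a, h⟩) id).det else 0, ?_, fun F => ?_⟩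
  · dsimp only
    rw [dif_pos n.lt_succ_self, Even.neg_one_pow ⟨n, rfl⟩, one_mul]
    unfold W wronskian
    congr 1
    ext a j
    have : Fin.succAbove (⟨n, n.lt_succ_self⟩ : Fin (n + 1)) a = a.castSucc :=
      Fin.succAbove_last_apply a
    rw [Matrix.submatrix_apply, this]
    rfl
  · unfold WApp wronskian
    rw [Matrix.det_succ_column _ (Fin.last n), sum_range]
    refine sum_congr rfl fun a _ => ?_
    dsimp only
    rw [dif_pos a.2, Fin.val_last, mul_right_comm]
    congr 2
    · refine congrArg Matrix.det ?_
      ext b j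
      simp only [Matrix.submatrix_apply, Matrix.of_apply, Fin.succAbove_last, Fin.snoc_castSucc]
      rfl
    · simp only [Matrix.of_apply, Fin.snoc_last]

/-! ### Row spans and the echelon form of the Wronskian matrix. -/

/-- `e` is a combination of the first `n` rows of the Wronskian matrix of `f_1, f_2, …`. -/
def RowSpan (d : Derivation ℤ A A) (f : ℕ → A) (n : ℕ) (e : ℕ → A) : Prop :=
  ∃ r : ℕ → A, ∀ k ≥ 1, e k = ∑ a ∈ range n, r a * (d^[a]) (f k)

namespace RowSpan

variable {d : Derivation ℤ A A} {f : ℕ → A} {n : ℕ} {e e' : ℕ → A}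

theorem zero : RowSpan d f n fun _ => 0 := ⟨fun _ => 0, fun k _ => by simp⟩

theorem add (h : RowSpan d f n e) (h' : RowSpan d f n e') : RowSpan d f n fun k => e k + e' k := by
  obtain ⟨r, hr⟩ := h
  obtain ⟨r', hr'⟩ := h'
  refine ⟨fun a => r a + r' a, fun k hk => ?_⟩
  dsimp only
  rw [hr k hk, hr' k hk, ← sum_add_distrib]
  exact sum_congr rfl fun a _ => (add_mul _ _ _).symm

theorem mul_left (c : A) (h : RowSpan d f n e) : RowSpan d f n fun k => c * e k := by
  obtain ⟨r, hr⟩ := h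
  refine ⟨fun a => c * r a, fun k hk => ?_⟩
  dsimp only
  rw [hr k hk, mul_sum]
  exact sum_congr rfl fun a _ => (mul_assoc _ _ _).symm

theorem sum {ι : Type*} (s : Finset ι) (g : ι → ℕ → A) (h : ∀ i ∈ s, RowSpan d f n (g i)) :
    RowSpan d f n fun k => ∑ i ∈ s, g i k := by
  classical
  induction s using Finset.induction_on with
  | empty => simpa using zero
  | insert i s hi ih =>
    simp only [sum_insert hi]
    exact (h i (mem_insert_self _ _)).add (ih fun j hj => h j (mem_insert_of_mem hj))

theorem row {a : ℕ} (ha : a < n) : RowSpan d f n fun k => (d^[a]) (f k) :=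
  ⟨fun b => if b = a then 1 else 0, fun k _ => by simp [ha]⟩

theorem congr (h : RowSpan d f n e) (he : ∀ k ≥ 1, e' k = e k) : RowSpan d f n e' := by
  obtain ⟨r, hr⟩ := h
  exact ⟨r, fun k hk => by rw [he k hk, hr k hk]⟩

theorem mono {m : ℕ} (hnm : n ≤ m) (h : RowSpan d f n e) : RowSpan d f m e := by
  obtain ⟨r, hr⟩ := h
  refine congr (sum (range n) (fun a k => r a * (d^[a]) (f k)) fun a ha => ?_) hr
  exact (row ((mem_range.1 ha).trans_le hnm)).mul_left _

/-- The derivative of row `a` is row `a + 1`, hence the extra row. -/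
theorem deriv (h : RowSpan d f n e) : RowSpan d f (n + 1) fun k => d (e k) := by
  obtain ⟨r, hr⟩ := h
  refine congr (e := fun k => ∑ a ∈ range n, (d (r a) * (d^[a]) (f k) +
    r a * (d^[a + 1]) (f k))) (sum _ _ fun a ha => ?_) fun k hk => ?_
  · rw [mem_range] at ha
    exact ((row (by omega)).mul_left _).add ((row (by omega)).mul_left _)
  · rw [hr k hk, map_sum]
    refine sum_congr rfl fun a _ => ?_
    rw [Derivation.leibniz, smul_eq_mul, smul_eq_mul, Function.iterate_succ_apply']
    ring

/-- The first `n` columns already determine the coefficients of the rows. This turns identities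
modulo earlier rows into equalities. -/
theorem eq_zero (hW : IsUnit (W d f n)) (h : RowSpan d f n e)
    (h0 : ∀ k < n, e (k + 1) = 0) {k : ℕ} (hk : 1 ≤ k) : e k = 0 := by
  obtain ⟨r, hr⟩ := h
  have := eq_zero_of_sum_mul_iterate_eq_zero d hW r fun k hk => by
    rw [← hr _ (by omega), h0 k hk]
  rw [hr k hk]
  exact sum_eq_zero fun a ha => by rw [this a (mem_range.1 ha), zero_mul]

end RowSpan

/-- The row-echelon entries `𝒲_n(f_k)/𝒲_{n+1}` of the Wronskian matrix. -/
noncomputable def echelon (d : Derivation ℤ A A) (f : ℕ → A) (n k : ℕ) : A :=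
  quo (WApp d f n (f k)) (W d f (n + 1))

section echelon

variable {d : Derivation ℤ A A} {f : ℕ → A}

theorem echelon_self (hW : ∀ k ≥ 1, IsUnit (W d f k)) (n : ℕ) : echelon d f n (n + 1) = 1 := by
  rw [echelon, WApp_self, quo_self (hW _ n.succ_pos)]

theorem echelon_eq_zero {n k : ℕ} (hk : 1 ≤ k) (hkn : k ≤ n) : echelon d f n k = 0 := by
  obtain ⟨i, rfl⟩ : ∃ i, k = i + 1 := ⟨k - 1, by omega⟩
  rw [echelon, WApp_eq_zero d f (by omega), quo, zero_mul]

theorem echelon_zero (hW : ∀ k ≥ 1, IsUnit (W d f k)) (n : ℕ) :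
    echelon d f n 1 = if n = 0 then 1 else 0 := by
  split_ifs with h
  · rw [h, echelon_self hW]
  · exact echelon_eq_zero le_rfl (by omega)

theorem rowSpan_echelon (n : ℕ) : RowSpan d f (n + 1) (echelon d f n) := by
  obtain ⟨R, -, hR⟩ := WApp_eq_sum d f n
  refine ⟨fun a => R a * Ring.inverse (W d f (n + 1)), fun k _ => ?_⟩
  rw [echelon, quo, hR, sum_mul]
  exact sum_congr rfl fun a _ => by ring

/-- A second derivation shifting the `f_k` up to multiples of `f_1` shifts their derivatives up to
earlier rows. -/
theorem rowSpan_deriv_iterate {δ : Derivation ℤ A A} (hcomm : ∀ g, d (δ g) = δ (d g)) {φ : A}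
    {σ : ℕ → A} (hσ : ∀ k ≥ 1, d (σ k) = φ * f k)
    (hδ : ∀ k ≥ 1, δ (f k) = f 1 * σ k + f (k + 1)) (a : ℕ) :
    RowSpan d f a fun k => δ ((d^[a]) (f k)) - (d^[a]) (f (k + 1)) - σ k * (d^[a]) (f 1) := by
  induction a with
  | zero =>
    refine RowSpan.zero.congr fun k hk => ?_
    simp only [Function.iterate_zero, id, hδ k hk]
    ring
  | succ a ih =>
    -- Differentiating `σ k` produces `φ * f k`, a multiple of row zero; this is the added term.
    refine (ih.deriv.add (((RowSpan.row (n := a + 1) a.succ_pos).mul_left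
      (φ * (d^[a]) (f 1))))).congr fun k hk => ?_
    simp only [map_sub, Derivation.leibniz, smul_eq_mul, hσ k hk, Function.iterate_succ_apply',
      hcomm, Function.iterate_zero, id]
    ring

/-- The coefficient of the top row in `echelon d f n` is `W_n/W_{n+1}`. The logarithmic derivative
cancels its variation, and the shift rule leaves only earlier rows, so the top row drops out. -/
theorem rowSpan_deriv_echelon {δ : Derivation ℤ A A} (hW : ∀ k ≥ 1, IsUnit (W d f k))
    (hcomm : ∀ g, d (δ g) = δ (d g)) {φ : A}
    {σ : ℕ → A} (hσ : ∀ k ≥ 1, d (σ k) = φ * f k)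
    (hδ : ∀ k ≥ 1, δ (f k) = f 1 * σ k + f (k + 1)) (n : ℕ) :
    RowSpan d f n fun k => δ (echelon d f n k) +
      dlog δ (quo (W d f (n + 1)) (W d f n)) * echelon d f n k - echelon d f n (k + 1) -
        σ k * echelon d f n 1 := by
  obtain ⟨R, hRn, hR⟩ := WApp_eq_sum d f n
  set ι := Ring.inverse (W d f (n + 1))
  set l := dlog δ (quo (W d f (n + 1)) (W d f n))
  have hWn : IsUnit (W d f n) := by
    rcases Nat.eq_zero_or_pos n with rfl | h
    · rw [W_zero]
      exact isUnit_one
    · exact hW n h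
  have hp : δ (R n * ι) + l * (R n * ι) = 0 := by
    refine dlog_of_mul_eq_one δ ?_
    have h1 := Ring.mul_inverse_cancel _ hWn
    have h2 : ι * W d f (n + 1) = 1 := Ring.inverse_mul_cancel _ (hW _ n.succ_pos)
    rw [hRn, quo]
    linear_combination (ι * W d f (n + 1)) * h1 + h2
  have he : ∀ k, echelon d f n k = ∑ a ∈ range (n + 1), R a * ι * (d^[a]) (f k) := by
    intro k
    rw [echelon, quo, hR, sum_mul]
    exact sum_congr rfl fun a _ => by ring
  refine RowSpan.congr (e := fun k => ∑ a ∈ range n, (δ (R a * ι) + l * (R a * ι)) *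
      (d^[a]) (f k) + ∑ a ∈ range (n + 1), R a * ι *
      (δ ((d^[a]) (f k)) - (d^[a]) (f (k + 1)) - σ k * (d^[a]) (f 1))) ?_ fun k hk => ?_
  · refine RowSpan.add (RowSpan.sum _ _ fun a ha => ?_) (RowSpan.sum _ _ fun a ha => ?_)
    · exact (RowSpan.row (mem_range.1 ha)).mul_left _
    · exact ((rowSpan_deriv_iterate hcomm hσ hδ a).mono
        (Nat.lt_succ_iff.1 (mem_range.1 ha))).mul_left _
  · have h0 : ∑ a ∈ range n, (δ (R a * ι) + l * (R a * ι)) * (d^[a]) (f k) =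
        ∑ a ∈ range (n + 1), (δ (R a * ι) + l * (R a * ι)) * (d^[a]) (f k) := by
      rw [sum_range_succ, hp, zero_mul, add_zero]
    rw [h0, he, he, he, map_sum, mul_sum, mul_sum, ← sum_add_distrib, ← sum_sub_distrib,
      ← sum_sub_distrib, ← sum_add_distrib]
    refine sum_congr rfl fun a _ => ?_
    rw [Derivation.leibniz (D := δ) (a := R a * ι), smul_eq_mul, smul_eq_mul]
    ring

/-- At level zero no rows remain, so the combination of `rowSpan_deriv_echelon` is zero. -/
theorem echelon_zero_succ {δ : Derivation ℤ A A} (hW : ∀ k ≥ 1, IsUnit (W d f k))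
    (hcomm : ∀ g, d (δ g) = δ (d g)) {φ : A}
    {σ : ℕ → A} (hσ : ∀ k ≥ 1, d (σ k) = φ * f k)
    (hδ : ∀ k ≥ 1, δ (f k) = f 1 * σ k + f (k + 1)) {k : ℕ} (hk : 1 ≤ k) :
    echelon d f 0 (k + 1) = δ (echelon d f 0 k) +
      dlog δ (quo (W d f 1) (W d f 0)) * echelon d f 0 k - σ k := by
  have h := (rowSpan_deriv_echelon hW hcomm hσ hδ 0).eq_zero (by rw [W_zero]; exact isUnit_one)
    (fun k hk => absurd hk (Nat.not_lt_zero k)) hk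
  rw [echelon_zero hW, if_pos rfl] at h
  linear_combination -h

/-- Adding `echelon d f n` cancels the only nonzero entry, in column `n + 1`, among the first `n +
1` columns, so `RowSpan.eq_zero` applies. The `σ` term is absent because column 1 vanishes at
positive levels. -/
theorem echelon_succ_succ {δ : Derivation ℤ A A} (hW : ∀ k ≥ 1, IsUnit (W d f k))
    (hcomm : ∀ g, d (δ g) = δ (d g)) {φ : A}
    {σ : ℕ → A} (hσ : ∀ k ≥ 1, d (σ k) = φ * f k)
    (hδ : ∀ k ≥ 1, δ (f k) = f 1 * σ k + f (k + 1)) (n : ℕ) {k : ℕ} (hk : 1 ≤ k) :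
    echelon d f (n + 1) (k + 1) = δ (echelon d f (n + 1) k) + echelon d f n k +
      dlog δ (quo (W d f (n + 2)) (W d f (n + 1))) * echelon d f (n + 1) k := by
  have h := ((rowSpan_deriv_echelon hW hcomm hσ hδ (n + 1)).add (rowSpan_echelon n)).eq_zero
    (hW _ n.succ_pos) (fun k hk => ?_) hk
  · rw [echelon_zero hW, if_neg n.succ_ne_zero] at h
    linear_combination -h
  · rw [echelon_zero hW, if_neg n.succ_ne_zero, echelon_eq_zero (k := k + 1) (by omega) hk,
      map_zero]
    rcases Nat.lt_or_ge k n with h | h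
    · rw [echelon_eq_zero (by omega) (by omega), echelon_eq_zero (by omega) (by omega)]
      ring
    · obtain rfl : k = n := by omega
      rw [echelon_self hW, echelon_self hW]
      ring

end echelon

end

end KP

namespace PseudoDiffOp

theorem D_mul_coeff {A : Type*} [CommRing A] {δ : Derivation ℤ A A} (P : PseudoDiffOp δ) (n : ℤ) :
    (D 1 * P).coeff n = P.coeff (n - 1) + δ (P.coeff n) := by
  have h := D_add_C_mul_coeff 0 P n
  rw [PseudoDiffOp.add_mul, add_coeff, C_mul_coeff, zero_mul, add_zero, add_zero] at h
  exact h

theorem D_sub_C_mul_coeff {A : Type*} [CommRing A] {δ : Derivation ℤ A A} (f : A)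
    (P : PseudoDiffOp δ) (n : ℤ) :
    ((D 1 - C f) * P).coeff n = P.coeff (n - 1) + (δ (P.coeff n) - f * P.coeff n) := by
  rw [sub_mul, sub_coeff, D_mul_coeff, C_mul_coeff, add_sub_assoc]

end PseudoDiffOp

namespace KP

theorem dlog_eq_neg {A : Type*} [CommRing A] (d : Derivation ℤ A A) {p q : A} (h : p * q = 1) :
    dlog d p = -dlog d q := by
  have h1 := dlog_of_mul_eq_one d h
  have h2 := dlog_of_mul_eq_one d ((mul_comm q p).trans h)
  have h3 : d (p * q) = 0 := by rw [h, Derivation.map_one_eq_zero]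
  rw [Derivation.leibniz, smul_eq_mul, smul_eq_mul] at h3
  linear_combination p * h2 + q * h1 - h3 - (dlog d p + dlog d q) * h

theorem sum_Icc_one {M : Type*} [AddCommMonoid M] (f : ℕ → M) (s : ℕ) :
    ∑ j ∈ Finset.Icc 1 s, f j = ∑ i ∈ Finset.range s, f (i + 1) := by
  rw [Finset.range_eq_Ico, Finset.sum_Ico_add' f 0 s 1]
  rfl

/-! ### Evolution of the potentials. -/

namespace GhostHierarchy

open PseudoDiffOp Finset

variable {A : Type u} [CommRing A] (G : GhostHierarchy A)

theorem isUnit_Φ_one : IsUnit (G.Φ 1) := by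
  simpa [W_one] using G.isUnit_W_Φ 1 le_rfl

theorem dtbar_Φ {s : ℕ} (hs : 1 ≤ s) {k : ℕ} (hk : 1 ≤ k) :
    G.dtbar s (G.Φ k) = ∑ i ∈ range s, G.Φ (s - i) * G.S k (i + 1) - G.Φ (k + s) := by
  rw [G.ghost_Φ s hs k hk, sum_Icc_one]
  simp only [Nat.add_sub_add_right]

theorem dtbar_Ψ {s : ℕ} (hs : 1 ≤ s) {k : ℕ} (hk : 1 ≤ k) :
    G.dtbar s (G.Ψ k) = ∑ i ∈ range s, G.Ψ (i + 1) * G.S (s - i) k + G.Ψ (k + s) := by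
  rw [G.ghost_Ψ s hs k hk, sum_Icc_one]
  simp only [Nat.add_sub_add_right]

theorem dbar_Φ {k : ℕ} (hk : 1 ≤ k) : G.dbar (G.Φ k) = G.Φ 1 * G.S k 1 - G.Φ (k + 1) := by
  simpa [dbar] using G.dtbar_Φ le_rfl hk

theorem dbar_Ψ {k : ℕ} (hk : 1 ≤ k) : G.dbar (G.Ψ k) = G.Ψ 1 * G.S 1 k + G.Ψ (k + 1) := by
  simpa [dbar] using G.dtbar_Ψ le_rfl hk

/-- The defect in the evolution equation of the potential `S m k` along `t̄_s`. -/
noncomputable def defect (s m k : ℕ) : A :=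
  G.dtbar s (G.S m k) - ∑ i ∈ range s, G.S m (i + 1) * G.S (s - i) k - G.S m (k + s) +
    G.S (m + s) k

/-- In `∂_x ∂_{t̄_s} S m k` the flows of `Φ_m` and `Ψ_k` produce exactly the terms subtracted in the
defect, which is thus a constant of integration. -/
theorem dx_defect {s m k : ℕ} (hs : 1 ≤ s) (hm : 1 ≤ m) (hk : 1 ≤ k) :
    G.dt 1 (G.defect s m k) = 0 := by
  have h1 : G.dt 1 (∑ i ∈ range s, G.S m (i + 1) * G.S (s - i) k) =
      G.Φ m * ∑ i ∈ range s, G.Ψ (i + 1) * G.S (s - i) k +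
        G.Ψ k * ∑ i ∈ range s, G.Φ (s - i) * G.S m (i + 1) := by
    rw [map_sum, mul_sum, mul_sum, ← sum_add_distrib]
    refine sum_congr rfl fun i hi => ?_
    rw [mem_range] at hi
    rw [Derivation.leibniz, G.dx_S m hm _ (by omega), G.dx_S _ (by omega) k hk, smul_eq_mul,
      smul_eq_mul]
    ring
  rw [defect, map_add, map_sub, map_sub, h1, G.dt_dtbar_comm 1 le_rfl s hs, G.dx_S m hm k hk,
    G.dx_S m hm _ (by omega), G.dx_S _ (by omega) k hk, Derivation.leibniz, G.dtbar_Φ hs hm,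
    G.dtbar_Ψ hs hk, smul_eq_mul, smul_eq_mul]
  ring

/-- This is the commutation of `∂̄` and `∂/∂t̄_s` on `Φ_m`, expanded by the flow equations. -/
theorem sum_defect {s m : ℕ} (hs : 1 ≤ s) (hm : 1 ≤ m) :
    ∑ i ∈ range s, G.Φ (s - i) * G.defect 1 m (i + 1) = G.Φ 1 * G.defect s m 1 := by
  have h := G.dtbar_comm 1 le_rfl s hs (G.Φ m)
  change G.dbar _ = G.dtbar s (G.dbar _) at h
  have hL : G.dbar (∑ i ∈ range s, G.Φ (s - i) * G.S m (i + 1)) =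
      ∑ i ∈ range s, ((G.Φ 1 * G.S (s - i) 1 - G.Φ (s - i + 1)) * G.S m (i + 1) +
        G.Φ (s - i) * G.dbar (G.S m (i + 1))) := by
    rw [map_sum]
    refine sum_congr rfl fun i hi => ?_
    rw [mem_range] at hi
    rw [Derivation.leibniz, G.dbar_Φ (by omega), smul_eq_mul, smul_eq_mul]
    ring
  -- The index-shift terms of the two flows telescope.
  have ht : ∑ i ∈ range s, (G.Φ (s - i + 1) * G.S m (i + 1) - G.Φ (s - i) * G.S m (i + 2)) =
      G.Φ (s + 1) * G.S m 1 - G.Φ 1 * G.S m (s + 1) := by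
    have := sum_range_sub' (fun i => G.Φ (s + 1 - i) * G.S m (i + 1)) s
    simp only [Nat.add_sub_add_right, Nat.add_sub_cancel_left, Nat.sub_zero, zero_add] at this
    rw [← this]
    refine sum_congr rfl fun i hi => ?_
    rw [mem_range] at hi
    rw [show s + 1 - i = s - i + 1 by omega]
  rw [G.dtbar_Φ hs hm, map_sub, hL, G.dbar_Φ hm, map_sub, G.dbar_Φ (by omega), Derivation.leibniz,
    G.dtbar_Φ hs le_rfl, G.dtbar_Φ hs (by omega), smul_eq_mul, smul_eq_mul] at h
  have hS : ∑ i ∈ range s, G.Φ (s - i) * G.defect 1 m (i + 1) =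
      ∑ i ∈ range s, ((G.Φ 1 * G.S (s - i) 1 - G.Φ (s - i + 1)) * G.S m (i + 1) +
        G.Φ (s - i) * G.dbar (G.S m (i + 1))) +
      ∑ i ∈ range s, (G.Φ (s - i + 1) * G.S m (i + 1) - G.Φ (s - i) * G.S m (i + 2)) -
      G.Φ 1 * ∑ i ∈ range s, G.S m (i + 1) * G.S (s - i) 1 -
      G.S m 1 * ∑ i ∈ range s, G.Φ (s - i) * G.S 1 (i + 1) +
      ∑ i ∈ range s, G.Φ (s - i) * G.S (m + 1) (i + 1) := by
    rw [mul_sum, mul_sum, ← sum_add_distrib, ← sum_sub_distrib, ← sum_sub_distrib,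
      ← sum_add_distrib]
    refine sum_congr rfl fun i _ => ?_
    simp only [defect, range_one, sum_singleton, zero_add, Nat.sub_zero, dbar]
    ring
  rw [hS, ht, defect, add_comm 1 s]
  rw [add_comm 1 s, add_right_comm m 1 s] at h
  linear_combination h

theorem defect_eq_zero {m k : ℕ} (hm : 1 ≤ m) (hk : 1 ≤ k) : G.defect 1 m k = 0 := by
  -- For `s = k + 1` the wanted defect multiplies `Φ_2`, whereas the unknown right-hand side only
  -- alters the coefficient of `Φ_1`.
  have h := G.sum_defect (s := k + 1) (by omega) hm
  have h0 := eq_zero_of_sum_mul_eq_zero (G.dt 1) (G.isUnit_W_Φ (k + 1) (by omega))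
    (fun i => G.defect 1 m (k + 1 - i) - if (i : ℕ) = 0 then G.defect (k + 1) m 1 else 0)
    (fun i => ?_) ?_
  · have := congrFun h0 ⟨1, by omega⟩
    simpa using this
  · rw [map_sub, G.dx_defect le_rfl hm (by omega)]
    split_ifs
    · rw [G.dx_defect (by omega) hm le_rfl, sub_zero]
    · rw [map_zero, sub_zero]
  · rw [← sum_range fun i => G.Φ (i + 1) * (G.defect 1 m (k + 1 - i) -
      if i = 0 then G.defect (k + 1) m 1 else 0)]
    simp only [mul_sub, sum_sub_distrib]
    rw [← sum_range_reflect, sum_range_succ' (fun i => G.Φ (i + 1) * if i = 0 then _ else 0)]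
    simp only [Nat.succ_ne_zero, if_false, mul_zero, sum_const_zero, zero_add, if_true]
    rw [← h, sub_eq_zero]
    refine sum_congr rfl fun i hi => ?_
    rw [mem_range] at hi
    rw [show k + 1 - 1 - i + 1 = k + 1 - i by omega, show k + 1 - (k + 1 - 1 - i) = i + 1 by omega]

/-- The evolution of the potentials along `t̄_1`; commutativity of the flows leaves no room for
constants of integration. -/
theorem dbar_S {m k : ℕ} (hm : 1 ≤ m) (hk : 1 ≤ k) :
    G.dbar (G.S m k) = G.S m 1 * G.S 1 k + G.S m (k + 1) - G.S (m + 1) k := by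
  have h := G.defect_eq_zero hm hk
  simp only [defect, range_one, sum_singleton, zero_add, Nat.sub_zero] at h
  rw [dbar]
  linear_combination h

/-! ### The dressing operator and the elimination of the potentials. -/

theorem ratio_zero : G.ratio 0 = 1 := quo_self G.isUnit_Φ_one

/-- The dressing operator `∑_{m ≥ 0} (Φ_{m+1}/Φ_1) D̄⁻ᵐ`. -/
noncomputable def dressing : PseudoDiffOp G.dbar :=
  ⟨fun n => if n ≤ 0 then G.ratio (-n).toNat else 0, 0, fun _ h => if_neg h.not_ge⟩

theorem dressing_coeff (n : ℤ) :
    G.dressing.coeff n = if n ≤ 0 then G.ratio (-n).toNat else 0 := rfl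

theorem dressing_coeff_neg (m : ℕ) : G.dressing.coeff (-m) = G.ratio m := by
  rw [dressing_coeff, if_pos (by omega)]
  simp

theorem dressing_coeff_zero : G.dressing.coeff 0 = 1 := by
  have := G.dressing_coeff_neg 0
  rwa [ratio_zero, Nat.cast_zero, neg_zero] at this

/-- The operator `D̄ᵏ + ∑_{m ≥ 1} S_{m,k} D̄^{1-m}` of potentials. -/
noncomputable def potential (k : ℕ) : PseudoDiffOp G.dbar :=
  ⟨fun n => if n ≤ 0 then G.S (1 - n).toNat k else if n = k then 1 else 0, k, fun n hn => by
    rw [if_neg (by omega), if_neg (by omega)]⟩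

theorem potential_coeff (k : ℕ) (n : ℤ) : (G.potential k).coeff n =
    if n ≤ 0 then G.S (1 - n).toNat k else if n = k then 1 else 0 := rfl

/-- The first factor is `Φ_1⁻¹ D̄ Φ_1`, so the coefficient at `D̄⁻ᵐ` is `(Φ_{m+2} + ∂̄Φ_{m+1})/Φ_1`,
which the first flow identifies with `S (m+1) 1`. -/
theorem factors_one_mul_dressing : G.factors 1 * G.dressing = G.potential 1 := by
  have hp : quo 1 (G.Φ 1) * G.Φ 1 = 1 := by
    rw [mul_comm, mul_quo_cancel G.isUnit_Φ_one]
  ext n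
  rw [factors, D_sub_C_mul_coeff, dlog_eq_neg _ hp, dressing_coeff, dressing_coeff,
    potential_coeff]
  rcases lt_trichotomy n 1 with h | h | h
  · obtain ⟨m, rfl⟩ : ∃ m : ℕ, n = -m := ⟨(-n).toNat, by omega⟩
    rw [if_pos (by omega), if_pos (by omega), if_pos (by omega),
      show (-(-(m : ℤ) - 1)).toNat = m + 1 by omega, show (-(-(m : ℤ))).toNat = m by omega,
      show (1 - -(m : ℤ)).toNat = m + 1 by omega, ratio, ratio, map_quo _ G.isUnit_Φ_one,
      G.dbar_Φ (by omega)]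
    have h1 := mul_quo_cancel (a := G.S (m + 1) 1) G.isUnit_Φ_one
    simp only [quo] at h1 ⊢
    linear_combination h1
  · subst h
    simp [G.ratio_zero]
  · rw [if_neg (by omega), if_neg (by omega), if_neg (by omega), if_neg (by omega)]
    simp

/-- In nonpositive degrees this is `dbar_S`; in positive degrees only the leading monomials matter.
-/
theorem D_mul_potential {k : ℕ} (hk : 1 ≤ k) :
    D 1 * G.potential k = G.potential (k + 1) + C (G.S 1 k) * G.potential 1 := by
  ext n
  rw [D_mul_coeff, add_coeff, C_mul_coeff]
  simp only [potential_coeff]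
  rcases lt_trichotomy n 1 with h | h | h
  · obtain ⟨m, rfl⟩ : ∃ m : ℕ, n = -m := ⟨(-n).toNat, by omega⟩
    rw [if_pos (by omega), if_pos (by omega), if_pos (by omega), if_pos (by omega),
      show (1 - (-(m : ℤ) - 1)).toNat = m + 2 by omega,
      show (1 - -(m : ℤ)).toNat = m + 1 by omega, G.dbar_S (by omega) hk]
    ring
  · subst h
    have h1 : G.dbar (if (1 : ℤ) = k then 1 else 0) = 0 := by split_ifs <;> simp
    have h2 : ¬ (1 : ℤ) = ((k + 1 : ℕ) : ℤ) := by omega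
    rw [if_neg (c := (1 : ℤ) ≤ 0) (by omega), if_neg (c := (1 : ℤ) ≤ 0) (by omega), h1, if_neg h2]
    simp
  · have h1 : G.dbar (if n = k then 1 else 0) = 0 := by split_ifs <;> simp
    have h2 : n - 1 = k ↔ n = ((k + 1 : ℕ) : ℤ) := by omega
    have h3 : ¬ n = ((1 : ℕ) : ℤ) := by omega
    rw [if_neg (c := n - 1 ≤ 0) (by omega), if_neg (c := n ≤ 0) (by omega),
      if_neg (c := n ≤ 0) (by omega), if_neg (c := n ≤ 0) (by omega), h1, if_neg h3]
    simp only [h2, add_zero, mul_zero]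

/-- Gaussian elimination of the potentials. -/
theorem potential_eq_sum (k : ℕ) : G.potential (k + 1) = ∑ j ∈ range (k + 1),
    C (echelon (G.dt 1) G.Ψ j (k + 1)) * (G.factors (j + 1) * G.dressing) := by
  induction k with
  | zero =>
    rw [sum_range_one, echelon_self G.isUnit_W_Ψ, factors_one_mul_dressing]
    exact (one_mul _).symm
  | succ k ih =>
    have hcomm : ∀ g, G.dt 1 (G.dbar g) = G.dbar (G.dt 1 g) :=
      G.dt_dtbar_comm 1 le_rfl 1 le_rfl
    have hσ : ∀ k ≥ 1, G.dt 1 (G.S 1 k) = G.Φ 1 * G.Ψ k := G.dx_S 1 le_rfl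
    have hδ : ∀ k ≥ 1, G.dbar (G.Ψ k) = G.Ψ 1 * G.S 1 k + G.Ψ (k + 1) := fun _ => G.dbar_Ψ
    set c := echelon (G.dt 1) G.Ψ with hc
    have h := G.D_mul_potential (k := k + 1) (by omega)
    have hk := echelon_eq_zero (d := G.dt 1) (f := G.Ψ) (n := k + 1) (k := k + 1) (by omega) le_rfl
    ext n
    have hn := congrArg (fun P => PseudoDiffOp.coeff P n) h
    rw [D_mul_coeff, add_coeff, C_mul_coeff, ← factors_one_mul_dressing] at hn
    rw [eq_sub_of_add_eq hn.symm, ih, sum_coeff, sum_coeff, sum_coeff, map_sum, ← sum_add_distrib]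
    set X : ℕ → PseudoDiffOp G.dbar := fun j => G.factors (j + 1) * G.dressing with hX
    have hXs : ∀ j, (X (j + 1)).coeff n = (X j).coeff (n - 1) + (G.dbar ((X j).coeff n) -
        dlog G.dbar (quo (W (G.dt 1) G.Ψ (j + 1)) (W (G.dt 1) G.Ψ j)) * (X j).coeff n) := by
      intro j
      rw [← D_sub_C_mul_coeff, hX]
      dsimp only
      rw [factors, PseudoDiffOp.mul_assoc]
    have h1 : ∀ j ∈ range (k + 1), (C (c j (k + 1)) * X j).coeff (n - 1) +
        G.dbar ((C (c j (k + 1)) * X j).coeff n) = c j (k + 1) * (X (j + 1)).coeff n +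
        (G.dbar (c j (k + 1)) + dlog G.dbar (quo (W (G.dt 1) G.Ψ (j + 1)) (W (G.dt 1) G.Ψ j)) *
          c j (k + 1)) * (X j).coeff n := by
      intro j _
      rw [C_mul_coeff, C_mul_coeff, hXs, Derivation.leibniz, smul_eq_mul, smul_eq_mul]
      ring
    have hc0 : c 0 (k + 1 + 1) = _ :=
      echelon_zero_succ G.isUnit_W_Ψ hcomm hσ hδ (k := k + 1) (by omega)
    -- The added term vanishes because the echelon matrix is zero below the diagonal; the range now
    -- matches the shifted sum.
    have h2 : ∑ j ∈ range (k + 1), (G.dbar (c j (k + 1)) +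
          dlog G.dbar (quo (W (G.dt 1) G.Ψ (j + 1)) (W (G.dt 1) G.Ψ j)) *
            c j (k + 1)) * (X j).coeff n =
        ∑ j ∈ range (k + 2), (G.dbar (c j (k + 1)) +
          dlog G.dbar (quo (W (G.dt 1) G.Ψ (j + 1)) (W (G.dt 1) G.Ψ j)) *
            c j (k + 1)) * (X j).coeff n := by
      rw [sum_range_succ _ (k + 1), hc, hk, map_zero, mul_zero, add_zero, zero_mul, add_zero]
    rw [sum_congr rfl h1, sum_add_distrib, h2, sum_range_succ' _ (k + 1),
      sum_range_succ' _ (k + 1), C_mul_coeff, hc0]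
    have h3 : ∀ j ∈ range (k + 1), (C (c (j + 1) (k + 1 + 1)) * X (j + 1)).coeff n =
        c j (k + 1) * (X (j + 1)).coeff n + (G.dbar (c (j + 1) (k + 1)) +
          dlog G.dbar (quo (W (G.dt 1) G.Ψ (j + 1 + 1)) (W (G.dt 1) G.Ψ (j + 1))) *
            c (j + 1) (k + 1)) * (X (j + 1)).coeff n := by
      intro j _
      rw [C_mul_coeff, hc, echelon_succ_succ G.isUnit_W_Ψ hcomm hσ hδ j (k := k + 1) (by omega)]
      ring
    have h4 := sum_congr rfl h3
    rw [sum_add_distrib] at h4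
    simp only [hX, zero_add] at h4 ⊢
    rw [h4]
    ring

theorem potential_eq_sum_of_le {k s : ℕ} (hk : k < s) : G.potential (k + 1) = ∑ j ∈ range s,
    C (echelon (G.dt 1) G.Ψ j (k + 1)) * (G.factors (j + 1) * G.dressing) := by
  rw [potential_eq_sum]
  refine sum_subset (range_subset_range.2 hk) fun j _ hj => ?_
  rw [mem_range] at hj
  rw [echelon_eq_zero (by omega) (by omega)]
  ext n
  rw [C_mul_coeff, zero_mul, zero_coeff]

/-! ### The action of `Mbar` on the dressing operator. -/

/-- Zeros of the echelon matrix allow the inner sum to run over all `k`, so the two summations can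
be exchanged. -/
theorem Mbar_eq_sum (s : ℕ) : G.Mbar s = ∑ j ∈ range s,
    C (∑ k ∈ range s, G.ratio (s - 1 - k) * echelon (G.dt 1) G.Ψ j (k + 1)) * G.factors (j + 1) -
      C (dlog (G.dtbar s) (G.Φ 1)) := by
  rw [Mbar, sum_Icc_one]
  refine congrArg (· - _) (sum_congr rfl fun j hj => ?_)
  refine congrArg (fun a => C a * _) ?_
  have h : ∑ k ∈ range s, G.ratio (s - 1 - k) * echelon (G.dt 1) G.Ψ j (k + 1) =
      ∑ k ∈ Icc 1 s, quo (G.Φ (s + 1 - k)) (G.Φ 1) * echelon (G.dt 1) G.Ψ j k := by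
    rw [sum_Icc_one]
    refine sum_congr rfl fun k hk => ?_
    rw [mem_range] at hk
    rw [ratio, show s - 1 - k + 1 = s + 1 - (k + 1) by omega]
  rw [h]
  refine sum_subset (fun k hk => ?_) fun k hk hk' => ?_
  · rw [mem_Icc] at hk ⊢
    omega
  · rw [mem_Icc] at hk hk'
    exact mul_eq_zero_of_right _ (echelon_eq_zero hk.1 (by omega))

/-- Undoing the elimination turns `M̄_s w` into `∑ (Φ_{s-k}/Φ_1) potential (k+1)`, `0 ≤ k < s`,
minus a multiple of `w`: the potentials give the flow of `Φ_{m+1}`, the leading monomials give the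
positive part of `w D̄ˢ`. -/
theorem Mbar_mul_dressing_coeff {s : ℕ} (hs : 1 ≤ s) (n : ℤ) :
    (G.Mbar s * G.dressing).coeff n =
      G.dressing.coeff (n - s) + G.dtbar s (G.dressing.coeff n) := by
  have h : (G.Mbar s * G.dressing).coeff n =
      ∑ k ∈ range s, G.ratio (s - 1 - k) * (G.potential (k + 1)).coeff n -
        dlog (G.dtbar s) (G.Φ 1) * G.dressing.coeff n := by
    rw [Mbar_eq_sum, sub_mul, sub_coeff, C_mul_coeff, sum_mul, sum_coeff]
    refine congrArg (· - _) ?_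
    have h1 : ∀ k ∈ range s, G.ratio (s - 1 - k) * (G.potential (k + 1)).coeff n =
        ∑ j ∈ range s, G.ratio (s - 1 - k) * echelon (G.dt 1) G.Ψ j (k + 1) *
          (G.factors (j + 1) * G.dressing).coeff n := by
      intro k hk
      rw [G.potential_eq_sum_of_le (mem_range.1 hk), sum_coeff, mul_sum]
      refine sum_congr rfl fun j _ => ?_
      rw [C_mul_coeff, mul_assoc]
    rw [sum_congr rfl h1, sum_comm]
    refine sum_congr rfl fun j _ => ?_
    rw [PseudoDiffOp.mul_assoc, C_mul_coeff, sum_mul]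
  rw [h, dressing_coeff, dressing_coeff]
  simp only [potential_coeff]
  rcases lt_or_ge n 1 with hn | hn
  · obtain ⟨m, rfl⟩ : ∃ m : ℕ, n = -m := ⟨(-n).toNat, by omega⟩
    rw [if_pos (by omega), if_pos (by omega), show (-(-(m : ℤ) - s)).toNat = m + s by omega,
      show (-(-(m : ℤ))).toNat = m by omega]
    -- The flow equation of `Φ_{m+1}`, divided by `Φ_1`.
    have h1 : ∑ k ∈ range s, G.ratio (s - 1 - k) *
        (if -(m : ℤ) ≤ 0 then G.S (1 - -(m : ℤ)).toNat (k + 1)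
          else if -(m : ℤ) = ((k + 1 : ℕ) : ℤ) then 1 else 0) =
        quo (G.dtbar s (G.Φ (m + 1)) + G.Φ (m + 1 + s)) (G.Φ 1) := by
      rw [G.dtbar_Φ hs (by omega), sub_add_cancel, quo, sum_mul]
      refine sum_congr rfl fun k hk => ?_
      rw [mem_range] at hk
      rw [if_pos (by omega), show (1 - -(m : ℤ)).toNat = m + 1 by omega, ratio, quo,
        show s - 1 - k + 1 = s - k by omega]
      ring
    rw [h1, ratio, ratio, map_quo _ G.isUnit_Φ_one, show m + s + 1 = m + 1 + s by omega]
    simp only [quo]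
    ring
  · rw [if_neg (c := n ≤ 0) (by omega), map_zero, mul_zero, add_zero, sub_zero]
    simp only [if_neg (show ¬ n ≤ 0 by omega)]
    split_ifs with h1
    · obtain ⟨k, rfl⟩ : ∃ k : ℕ, n = ((k + 1 : ℕ) : ℤ) := ⟨(n - 1).toNat, by omega⟩
      rw [sum_eq_single_of_mem k (mem_range.2 (by omega)) fun j _ hj => ?_, if_pos rfl, mul_one]
      · congr 1
        omega
      · rw [if_neg (by omega), mul_zero]
    · refine sum_eq_zero fun k hk => ?_
      rw [mem_range] at hk
      rw [if_neg (by omega), mul_zero]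

/-- `M̄_s` is a differential operator. -/
theorem Mbar_coeff_neg (s : ℕ) {n : ℤ} (hn : n < 0) : (G.Mbar s).coeff n = 0 := by
  have h : ∀ j, ∀ n : ℤ, n < 0 → (G.factors j).coeff n = 0 := by
    intro j
    induction j using Nat.twoStepInduction with
    | zero => exact fun n hn => if_neg hn.ne
    | one =>
      intro n hn
      rw [factors, sub_coeff, D_coeff, C_coeff, if_neg (by omega), if_neg hn.ne, sub_zero]
    | more j _ ih =>
      intro n hn
      rw [factors, D_sub_C_mul_coeff, ih _ hn, ih _ (by omega), map_zero, mul_zero, sub_zero,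
        add_zero]
  rw [Mbar_eq_sum, sub_coeff, sum_coeff, C_coeff, if_neg hn.ne, sub_zero]
  exact sum_eq_zero fun j _ => by rw [C_mul_coeff, h _ _ hn, mul_zero]

end GhostHierarchy
end KP

/-! ### Cancelling a monic factor of order zero. -/

namespace PseudoDiffOp

theorem mul_coeff_top {A : Type*} [CommRing A] {δ : Derivation ℤ A A} {P Q : PseudoDiffOp δ}
    {N M : ℤ} (hN : ∀ n, N < n → P.coeff n = 0) (hM : ∀ n, M < n → Q.coeff n = 0) :
    (P * Q).coeff (N + M) = P.coeff N * Q.coeff M := by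
  rw [mul_coeff_eq_sum hN hM (N + M) N 0 (by omega) (by simp)]
  simp

/-- An operator is of negative order as soon as its product with a monic operator of order zero
is. -/
theorem coeff_eq_zero_of_mul_coeff_eq_zero {A : Type*} [CommRing A] {δ : Derivation ℤ A A}
    {P Q : PseudoDiffOp δ} (hQ : ∀ n, 0 < n → Q.coeff n = 0) (hQ0 : Q.coeff 0 = 1)
    (h : ∀ n, 0 ≤ n → (P * Q).coeff n = 0) (n : ℤ) (hn : 0 ≤ n) : P.coeff n = 0 := by
  obtain ⟨N, hN⟩ := P.bounded
  -- Descent from the top order: at each stage the leading coefficient of `P` equals that of `P *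
  -- Q`.
  have key : ∀ j : ℕ, ∀ n, -1 < n → N - j < n → P.coeff n = 0 := by
    intro j
    induction j with
    | zero => exact fun n _ h => hN n (by simpa using h)
    | succ j ih =>
      intro n hn hj
      have h1 : ∀ m, n < m → P.coeff m = 0 := fun m hm => by
        push_cast at hj
        exact ih m (by omega) (by omega)
      have h2 := mul_coeff_top h1 hQ
      rw [add_zero, hQ0, mul_one] at h2
      rw [← h2, h n (by omega)]
  exact key (N + 1).toNat n (by omega) (by omega)

end PseudoDiffOp

/-! ### Universal jet polynomials. -/

namespace KP

namespace GhostHierarchy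

open PseudoDiffOp Finset

/-- `f` is a universal polynomial with integer coefficients in the jets of order below `K`. -/
def IsJetPoly (K : ℕ) (f : ∀ (A : Type u) [CommRing A], GhostHierarchy A → A) : Prop :=
  ∃ P : MvPolynomial ((Fin (K - 1) × ℕ) ⊕ (Fin (K - 1) × ℕ)) ℤ,
    ∀ (A : Type u) [CommRing A] (G : GhostHierarchy A), f A G = MvPolynomial.aeval (G.lowerJets K) P

namespace IsJetPoly

variable {K : ℕ} {f g : ∀ (A : Type u) [CommRing A], GhostHierarchy A → A}

theorem intCast (c : ℤ) : IsJetPoly.{u} K fun _ _ _ => (c : _) :=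
  ⟨MvPolynomial.C c, fun A _ G => by simp⟩

theorem add (hf : IsJetPoly K f) (hg : IsJetPoly K g) :
    IsJetPoly K fun A _ G => f A G + g A G := by
  obtain ⟨P, hP⟩ := hf
  obtain ⟨Q, hQ⟩ := hg
  exact ⟨P + Q, fun A _ G => by rw [map_add, ← hP, ← hQ]⟩

theorem neg (hf : IsJetPoly K f) : IsJetPoly K fun A _ G => -f A G := by
  obtain ⟨P, hP⟩ := hf
  exact ⟨-P, fun A _ G => by rw [map_neg, ← hP]⟩

theorem sub (hf : IsJetPoly K f) (hg : IsJetPoly K g) :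
    IsJetPoly K fun A _ G => f A G - g A G := by
  simpa only [sub_eq_add_neg] using hf.add hg.neg

theorem mul (hf : IsJetPoly K f) (hg : IsJetPoly K g) :
    IsJetPoly K fun A _ G => f A G * g A G := by
  obtain ⟨P, hP⟩ := hf
  obtain ⟨Q, hQ⟩ := hg
  exact ⟨P * Q, fun A _ G => by rw [map_mul, ← hP, ← hQ]⟩

theorem sum {ι : Type*} (s : Finset ι) (F : ι → ∀ (A : Type u) [CommRing A], GhostHierarchy A → A)
    (h : ∀ i ∈ s, IsJetPoly K (F i)) : IsJetPoly K fun A _ G => ∑ i ∈ s, F i A G := by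
  classical
  induction s using Finset.induction_on with
  | empty => simpa using intCast 0
  | insert i s hi ih =>
    simp only [sum_insert hi]
    exact (h i (mem_insert_self _ _)).add (ih fun j hj => h j (mem_insert_of_mem hj))

theorem mono {L : ℕ} (hKL : K ≤ L) (hf : IsJetPoly K f) : IsJetPoly L f := by
  obtain ⟨P, hP⟩ := hf
  have h : K - 1 ≤ L - 1 := by omega
  refine ⟨MvPolynomial.rename (Sum.map (Prod.map (Fin.castLE h) id)
    (Prod.map (Fin.castLE h) id)) P, fun A _ G => ?_⟩
  rw [hP, MvPolynomial.aeval_rename]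
  congr 2
  funext x
  rcases x with ⟨j, n⟩ | ⟨j, n⟩ <;> rfl

/-- The derivation `∂̄` lifts to the polynomial ring as the derivation raising the jet order `n` by
one. -/
theorem dbar (hf : IsJetPoly K f) : IsJetPoly K fun A _ G => G.dbar (f A G) := by
  obtain ⟨P, hP⟩ := hf
  let T : Derivation ℤ (MvPolynomial ((Fin (K - 1) × ℕ) ⊕ (Fin (K - 1) × ℕ)) ℤ)
      (MvPolynomial ((Fin (K - 1) × ℕ) ⊕ (Fin (K - 1) × ℕ)) ℤ) :=
    MvPolynomial.mkDerivation ℤ fun x =>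
      MvPolynomial.X (Sum.map (Prod.map id Nat.succ) (Prod.map id Nat.succ) x)
  refine ⟨T P, fun A _ G => ?_⟩
  have key : ∀ Q, G.dbar (MvPolynomial.aeval (G.lowerJets K) Q) =
      MvPolynomial.aeval (G.lowerJets K) (T Q) := by
    intro Q
    induction Q using MvPolynomial.induction_on with
    | C a => simp
    | add Q R hQ hR => rw [map_add, map_add, map_add, map_add, hQ, hR]
    | mul_X Q x hQ =>
      have hx : G.dbar (G.lowerJets K x) = MvPolynomial.aeval (G.lowerJets K)
          (T (MvPolynomial.X x)) := by
        rw [MvPolynomial.mkDerivation_X, MvPolynomial.aeval_X]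
        rcases x with ⟨j, n⟩ | ⟨j, n⟩ <;> exact (Function.iterate_succ_apply' _ _ _).symm
      simp only [map_mul, map_add, Derivation.leibniz, smul_eq_mul, MvPolynomial.aeval_X, hx, hQ]
  rw [← key, ← hP]

theorem ratio {m : ℕ} (hm : m < K) : IsJetPoly.{u} K fun _ _ G => G.ratio m := by
  rcases m with _ | m
  · simpa only [ratio_zero, Int.cast_one] using intCast 1
  · exact ⟨MvPolynomial.X (.inl (⟨m, by omega⟩, 0)), fun A _ G => by
      rw [MvPolynomial.aeval_X]
      rfl⟩

theorem dlogRatio {m : ℕ} (hm : m + 1 < K) : IsJetPoly.{u} K fun _ _ G => G.dlogRatio (m + 1) :=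
  ⟨MvPolynomial.X (.inr (⟨m, by omega⟩, 0)), fun A _ G => by
    rw [MvPolynomial.aeval_X]
    rfl⟩

end IsJetPoly

/-! ### Construction of the Lax operator. -/

section

variable {A : Type u} [CommRing A] (G : GhostHierarchy A)

theorem dressing_coeff_pos {n : ℤ} (hn : 0 < n) : G.dressing.coeff n = 0 := if_neg hn.not_ge

theorem invFactors_mul_dressing_coeff_eq_zero (k : ℕ) {n : ℤ} (hn : -(k : ℤ) < n) :
    (G.invFactors k * G.dressing).coeff n = 0 :=
  mul_coeff_eq_zero (G.invFactors_coeff k) (fun _ => G.dressing_coeff_pos) n (by simpa using hn)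

theorem invFactors_zero_mul_dressing : G.invFactors 0 * G.dressing = G.dressing := one_mul _

/-- Left multiplication by the newest first-order factor cancels its inverse; read downwards, this
computes each coefficient from higher ones. -/
theorem invFactors_succ_mul_dressing_coeff (k : ℕ) (n : ℤ) :
    (G.invFactors (k + 1) * G.dressing).coeff (n - 1) = (G.invFactors k * G.dressing).coeff n -
      (G.dbar ((G.invFactors (k + 1) * G.dressing).coeff n) +
        G.dlogRatio (k + 1) * (G.invFactors (k + 1) * G.dressing).coeff n) := by
  have h : (D 1 + C (G.dlogRatio (k + 1))) * (G.invFactors (k + 1) * G.dressing) =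
      G.invFactors k * G.dressing := by
    rw [invFactors, ← PseudoDiffOp.mul_assoc, ← PseudoDiffOp.mul_assoc, D_add_C_mul_invDAdd]
    exact congrArg (· * _) (one_mul (G.invFactors k))
  rw [← h, D_add_C_mul_coeff]
  ring

theorem invFactors_mul_dressing_coeff_self (k : ℕ) :
    (G.invFactors k * G.dressing).coeff (-k) = 1 := by
  induction k with
  | zero => simpa [invFactors_zero_mul_dressing] using G.dressing_coeff_zero
  | succ k ih =>
    rw [show -((k + 1 : ℕ) : ℤ) = -k - 1 by push_cast; ring, invFactors_succ_mul_dressing_coeff,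
      ih, G.invFactors_mul_dressing_coeff_eq_zero (k + 1) (by push_cast; omega), map_zero,
      mul_zero, add_zero, sub_zero]

/-- The coefficients `b_n` of the Lax operator `L̄`. -/
noncomputable def laxCoeff (n : ℕ) : A :=
  -- Solves the coefficient at `D̄⁻ⁿ` of `L̄ w = w D̄` for `b_n`, whose own factor there is 1.
  -G.dbar (G.ratio n) - ∑ k : Fin n, if 1 ≤ (k : ℕ) then
    laxCoeff k * (G.invFactors k * G.dressing).coeff (-n) else 0
termination_by n
decreasing_by exact k.2

/-- The tail `∑_{k ≥ 1} b_k (D̄ + ∂̄ ln(W_{k+1}/W_k))⁻¹ ⋯ (D̄ + ∂̄ ln(W_2/Φ_1))⁻¹` of `L̄` multiplies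
the dressing operator termwise. -/
theorem exists_Lbar_eq_D_add (b : ℕ → A) : ∃ T : PseudoDiffOp G.dbar, G.Lbar b = D 1 + T ∧
    (∀ n > 0, (T * G.dressing).coeff n = 0) ∧
    ∀ K : ℕ, (T * G.dressing).coeff (-K) = ∑ k ∈ range (K + 1),
      if 1 ≤ k then b k * (G.invFactors k * G.dressing).coeff (-K) else 0 := by
  refine ⟨_, rfl, fun n hn => ?_, fun K => ?_⟩
  · refine mul_coeff_eq_zero (N := 0) (M := 0) (fun m hm => ?_) (fun _ => G.dressing_coeff_pos)
      n (by simpa using hn)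
    refine (finsum_congr fun k => ?_).trans finsum_zero
    rw [G.invFactors_coeff k m (by omega), mul_zero, ite_self]
  · set T : PseudoDiffOp G.dbar := ⟨_, _⟩
    -- Terms with `k > K` have order below `-K`, so this truncation has the same coefficient at
    -- `D̄^{-K}`.
    set S : PseudoDiffOp G.dbar := ∑ k ∈ range (K + 1), C (if 1 ≤ k then b k else 0) *
      G.invFactors k with hS
    have h : T * G.dressing = S * G.dressing + (T - S) * G.dressing := by
      rw [← add_mul, add_sub_cancel]
    rw [h, add_coeff, mul_coeff_eq_zero (P := T - S) (N := -K - 1) (M := 0) ?_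
      (fun _ => G.dressing_coeff_pos) _ (by omega), add_zero, hS, sum_mul, sum_coeff]
    · refine sum_congr rfl fun k _ => ?_
      rw [PseudoDiffOp.mul_assoc, C_mul_coeff, ite_mul, zero_mul]
    · intro m hm
      rw [sub_coeff, hS, sum_coeff, sub_eq_zero]
      refine (finsum_eq_sum_of_support_subset (s := range (K + 1)) _ fun k hk => ?_).trans
        (sum_congr rfl fun k _ => ?_)
      · by_contra hc
        rw [mem_coe, mem_range] at hc
        exact hk (by simp [G.invFactors_coeff k m (by omega)])
      · rw [C_mul_coeff, ite_mul, zero_mul]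

theorem Lbar_mul_dressing : G.Lbar G.laxCoeff * G.dressing = G.dressing * D 1 := by
  obtain ⟨T, hT, h0, hK⟩ := G.exists_Lbar_eq_D_add G.laxCoeff
  ext n
  rw [hT, add_mul, add_coeff, D_mul_coeff, mul_D_coeff, add_assoc, add_eq_left]
  rcases lt_or_ge 0 n with hn | hn
  · rw [G.dressing_coeff_pos hn, h0 n hn, map_zero, add_zero]
  · obtain ⟨K, rfl⟩ : ∃ K : ℕ, n = -K := ⟨(-n).toNat, by omega⟩
    rw [hK, dressing_coeff_neg, sum_range_succ, invFactors_mul_dressing_coeff_self, mul_one]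
    rcases K with _ | K
    · simp [ratio_zero]
    · rw [if_pos (by omega), laxCoeff, ← sum_range fun k => if 1 ≤ k then
        G.laxCoeff k * (G.invFactors k * G.dressing).coeff (-(K + 1 : ℕ)) else 0]
      ring

theorem Lbar_pow_mul_dressing_coeff (s : ℕ) (n : ℤ) :
    (G.Lbar G.laxCoeff ^ s * G.dressing).coeff n = G.dressing.coeff (n - s) := by
  induction s generalizing n with
  | zero =>
    rw [Nat.cast_zero, sub_zero]
    exact congrArg (fun P => PseudoDiffOp.coeff P n) (one_mul G.dressing)
  | succ s ih =>
    change (G.Lbar G.laxCoeff ^ s * G.Lbar G.laxCoeff * G.dressing).coeff n = _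
    rw [PseudoDiffOp.mul_assoc, Lbar_mul_dressing, ← PseudoDiffOp.mul_assoc, mul_D_coeff, ih]
    congr 1
    push_cast
    ring

/-- Multiplied by `w`, the difference becomes `∂w/∂t̄_s`, of negative order. -/
theorem Mbar_eq_pos {s : ℕ} (hs : 1 ≤ s) : G.Mbar s = pos (G.Lbar G.laxCoeff ^ s) := by
  ext n
  change _ = if 0 ≤ n then _ else _
  split_ifs with hn
  · rw [← sub_eq_zero, ← sub_coeff]
    refine coeff_eq_zero_of_mul_coeff_eq_zero (fun _ => G.dressing_coeff_pos)
      G.dressing_coeff_zero (fun m hm => ?_) n hn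
    rw [sub_mul, sub_coeff, Mbar_mul_dressing_coeff _ hs, Lbar_pow_mul_dressing_coeff,
      add_sub_cancel_left]
    rcases hm.eq_or_lt with rfl | hm
    · rw [dressing_coeff_zero, Derivation.map_one_eq_zero]
    · rw [G.dressing_coeff_pos hm, map_zero]
  · exact G.Mbar_coeff_neg s (not_le.1 hn)

end

/-! ### Polynomial form of the Lax coefficients. -/

/-- Each inverse factor lowers the order by one, so only the ratios of index at most `m - k < K`
enter. -/
theorem isJetPoly_invFactors_mul_dressing {K k : ℕ} (hk : k < K) {m : ℕ} (hm : m < K + k) :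
    IsJetPoly.{u} K fun _ _ G => (G.invFactors k * G.dressing).coeff (-m) := by
  induction k generalizing m with
  | zero =>
    simpa only [invFactors_zero_mul_dressing, dressing_coeff_neg] using
      IsJetPoly.ratio (K := K) hm
  | succ k ih =>
    induction m with
    | zero =>
      have h : ∀ (A : Type u) [CommRing A] (G : GhostHierarchy A),
          (G.invFactors (k + 1) * G.dressing).coeff (-((0 : ℕ) : ℤ)) = ((0 : ℤ) : A) := by
        intro A _ G
        rw [G.invFactors_mul_dressing_coeff_eq_zero (k + 1) (by push_cast; omega), Int.cast_zero]
      simpa only [h] using IsJetPoly.intCast 0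
    | succ m ihm =>
      have h : ∀ (A : Type u) [CommRing A] (G : GhostHierarchy A),
          (G.invFactors (k + 1) * G.dressing).coeff (-((m + 1 : ℕ) : ℤ)) =
          (G.invFactors k * G.dressing).coeff (-m) -
      (G.dbar ((G.invFactors (k + 1) * G.dressing).coeff (-m)) +
        G.dlogRatio (k + 1) * (G.invFactors (k + 1) * G.dressing).coeff (-m)) := by
        intro A _ G
        rw [← invFactors_succ_mul_dressing_coeff]
        congr 1
        push_cast
        ring
      simp only [h]
      have h1 := ihm (by omega)
      exact (ih (by omega) (by omega)).sub (h1.dbar.add ((IsJetPoly.dlogRatio hk).mul h1))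

theorem isJetPoly_laxCoeff_add (n : ℕ) :
    IsJetPoly.{u} n fun _ _ G => G.laxCoeff n + G.dbar (G.ratio n) := by
  induction n using Nat.strong_induction_on with
  | _ n ih =>
    have h : ∀ (A : Type u) [CommRing A] (G : GhostHierarchy A),
        G.laxCoeff n + G.dbar (G.ratio n) = -∑ k : Fin n, if 1 ≤ (k : ℕ) then
          (G.laxCoeff k + G.dbar (G.ratio k) - G.dbar (G.ratio k)) *
            (G.invFactors k * G.dressing).coeff (-n) else 0 := by
      intro A _ G
      simp only [add_sub_cancel_right]
      rw [laxCoeff]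
      ring
    simp only [h]
    refine (IsJetPoly.sum _ _ fun k _ => ?_).neg
    by_cases hk : 1 ≤ (k : ℕ)
    · simp only [if_pos hk]
      -- Since `k ≥ 1`, the top ratio of index `n` cannot enter here.
      exact (((ih k k.2).mono k.2.le).sub (IsJetPoly.ratio k.2).dbar).mul
        (isJetPoly_invFactors_mul_dressing k.2 (by omega))
    · simp only [if_neg hk]
      simpa only [Int.cast_zero] using IsJetPoly.intCast 0

end GhostHierarchy
end KP

theorem mainTheorem2 :
    ∃ P : (k : ℕ) → MvPolynomial ((Fin (k - 1) × ℕ) ⊕ (Fin (k - 1) × ℕ)) ℤ,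
      ∀ (A : Type u) [CommRing A] (G : KP.GhostHierarchy A), ∃ b : ℕ → A,
        (∀ s ≥ 1, G.Mbar s = PseudoDiffOp.pos (G.Lbar b ^ s)) ∧
        b 1 = -G.dbar (KP.quo (G.Φ 2) (G.Φ 1)) ∧
        ∀ k ≥ 2, b k = -G.dbar (KP.quo (G.Φ (k + 1)) (G.Φ 1)) +
          MvPolynomial.aeval (G.lowerJets k) (P k) := by
  -- The polynomials are fixed before the ring and the solution are given.
  choose P hP using KP.GhostHierarchy.isJetPoly_laxCoeff_add.{u}
  refine ⟨P, fun A _ G => ⟨G.laxCoeff, fun s hs => G.Mbar_eq_pos hs, ?_, fun k _ => ?_⟩⟩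
  -- For `n = 1` the recursive sum has only the excluded index 0.
  · rw [KP.GhostHierarchy.laxCoeff]
    simp [KP.GhostHierarchy.ratio]
  · rw [← hP k A G, neg_add_eq_sub]
    exact (add_sub_cancel_right _ _).symm
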